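/- **Setting.** Polynomials are elements of $\mathbb{C}[x_1,x_2,\dots]$. An *IHL circuit over the arity-3 basis* is a finite acyclic directed graph (multiple edges allowed) in which every leaf is labelled by a homogeneous linear polynomial, every other vertex is either an addition gate of arity exactly $2$ or a product gate of arity exactly $3$, and every edge carries a scalar of $\mathbb{C}$ by which the polynomial passed along it is multiplied. For a polynomial $f$ with homogeneous components $f_d$, a *graded IHL circuit over the arity-3 basis computing $f$* is a circuit of the syntactic shape $$f \;=\; f(0)\;+\;\sum_{d\ \mathrm{odd}} f_d\;+\;\sum_{\substack{d\ \mathrm{even}\\ d\ge 2}}\tfrac1d\sum_i x_i\cdot \frac{\partial f_d}{\partial x_i},$$ where each $f_d$ ($d$ odd) and each $\partial f_d/\partial x_i$ ($d\ge2$ even) is computed at a vertex of an IHL circuit over the arity-3 basis (the blocks may share gates; vanishing summands may be omitted), and the outer sum is a tree of binary additions. Its *size* is its total number of vertices, its *depth* the length of a longest path from the root to a leaf. It is *homogeneous* if every gate of its IHL part computes a homogeneous polynomial. **Theorem (VSBR depth reduction over the arity-3 basis).** 1. There is a constant $c$ such that the following holds. Let $f$ be a polynomial of degree $d$ computed by a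 homogeneous graded IHL circuit of size $s$ over the arity-3 basis. Then $f$ is also computed by a homogeneous graded IHL circuit over the arity-3 basis of size at most $c\,s^{c}$ and depth at most $c\,(1+\log s\cdot\log d)$. 2. For every $k\in\mathbb{N}$ there is a constant $c$ such that the same conclusion holds for every polynomial $f$ of degree $d$ computed by an arbitrary (not necessarily homogeneous) graded IHL circuit of size $s$ over the arity-3 basis with $d\le s^{k}$. (Here $\log d$ is read as $0$ when $d=0$.) -/

import Mathlib

namespace ArityThree

open MvPolynomial

/-- The polynomial ring `ℂ[x₀, x₁, …]`. -/
abbrev Poly : Type := MvPolynomial ℕ ℂ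

/-- A gate of an input-homogeneous-linear circuit over the arity-3 basis, with vertex set `V`:
a leaf carrying a homogeneous linear polynomial, a binary addition gate `a • u + b • v`, or
a ternary product gate `(a • u) × (b • v) × (c • w)`. The scalars are the edge labels. -/
inductive Gate (V : Type) : Type
  | leaf (l : Poly) (hl : l.IsHomogeneous 1) : Gate V
  | add (a b : ℂ) (u v : V) : Gate V
  | mul (a b c : ℂ) (u v w : V) : Gate V

/-- The vertices that feed into a gate. -/
def Gate.children {V : Type} : Gate V → List V
  | .leaf _ _ => []
  | .add _ _ u v => [u, v]
  | .mul _ _ _ u v w => [u, v, w]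

/-- The polynomial computed by a gate, given the polynomials computed at its children. -/
noncomputable def Gate.value {V : Type} :
    (g : Gate V) → (∀ u : V, u ∈ g.children → Poly) → Poly
  | .leaf l _, _ => l
  | .add a b u v, p =>
      C a * p u (by simp [Gate.children]) + C b * p v (by simp [Gate.children])
  | .mul a b c u v w, p =>
      (C a * p u (by simp [Gate.children])) * (C b * p v (by simp [Gate.children])) *
        (C c * p w (by simp [Gate.children]))

/-- The length of a longest path from a gate down to a leaf, given these lengths at its
children. -/
def Gate.height {V : Type} :
    (g : Gate V) → (∀ u : V, u ∈ g.children → ℕ) → ℕ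
  | .leaf _ _, _ => 0
  | .add _ _ u v, h =>
      max (h u (by simp [Gate.children])) (h v (by simp [Gate.children])) + 1
  | .mul _ _ _ u v w, h =>
      max (max (h u (by simp [Gate.children])) (h v (by simp [Gate.children])))
        (h w (by simp [Gate.children])) + 1

/-- An input-homogeneous-linear (IHL) circuit over the arity-3 basis, possibly with several
outputs: a finite acyclic directed multigraph of gates. For a finite vertex set, acyclicity is
the same as well-foundedness of the child relation. -/
structure IHLCircuit : Type 1 where
  V : Type
  fintypeV : Fintype V
  gate : V → Gate V
  acyclic : WellFounded fun u v : V => u ∈ (gate v).children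

namespace IHLCircuit

/-- The number of vertices. -/
def size (K : IHLCircuit) : ℕ := @Fintype.card K.V K.fintypeV

/-- The polynomial computed at a vertex. -/
noncomputable def eval (K : IHLCircuit) : K.V → Poly :=
  K.acyclic.fix fun v ih => (K.gate v).value ih

/-- The length of a longest path from a vertex down to a leaf. -/
noncomputable def height (K : IHLCircuit) : K.V → ℕ :=
  K.acyclic.fix fun v ih => (K.gate v).height ih

theorem eval_eq (K : IHLCircuit) (v : K.V) :
    K.eval v = (K.gate v).value fun u _ => K.eval u :=
  K.acyclic.fix_eq _ v

theorem height_eq (K : IHLCircuit) (v : K.V) :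
    K.height v = (K.gate v).height fun u _ => K.height u :=
  K.acyclic.fix_eq _ v

/-- Every gate computes a homogeneous polynomial (of a degree depending on the gate). -/
def IsHomogeneous (K : IHLCircuit) : Prop :=
  ∀ v : K.V, ∃ n : ℕ, (K.eval v).IsHomogeneous n

end IHLCircuit

/-- The top part of a graded circuit, a tree of binary additions. Its summands are a field
constant, a vertex `v` meant to compute a component of odd degree `d`, or
`(1 / d) * x i * v` with `v` meant to compute the partial derivative with respect to `x i` of
a component of even degree `d`. -/
inductive SumTree (V : Type) : Type
  | const (c : ℂ) : SumTree V
  | odd (d : ℕ) (v : V) : SumTree V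
  | even (d i : ℕ) (v : V) : SumTree V
  | add (S T : SumTree V) : SumTree V

namespace SumTree

/-- The constants among the summands. -/
def consts {V : Type} : SumTree V → List ℂ
  | .const c => [c]
  | .odd _ _ => []
  | .even _ _ _ => []
  | .add S T => S.consts ++ T.consts

/-- The degrees `d` of the summands of odd type. -/
def oddIndices {V : Type} : SumTree V → List ℕ
  | .const _ => []
  | .odd d _ => [d]
  | .even _ _ _ => []
  | .add S T => S.oddIndices ++ T.oddIndices

/-- The pairs `(d, i)` of the summands of even type. -/
def evenIndices {V : Type} : SumTree V → List (ℕ × ℕ)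
  | .const _ => []
  | .odd _ _ => []
  | .even d i _ => [(d, i)]
  | .add S T => S.evenIndices ++ T.evenIndices

/-- The number of vertices that the top part adds to those of the circuit below it: one for a
constant, one for an addition, and two (the leaf `x i` and a product gate, the factor `1 / d`
being an edge label) for a summand of even type. -/
def size {V : Type} : SumTree V → ℕ
  | .const _ => 1
  | .odd _ _ => 0
  | .even _ _ _ => 2
  | .add S T => S.size + T.size + 1

/-- The length of a longest path from the root of the top part to a leaf, where `h` gives the
lengths below the vertices in `V`. -/
def height {V : Type} (h : V → ℕ) : SumTree V → ℕ
  | .const _ => 0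
  | .odd _ v => h v
  | .even _ _ v => h v + 1
  | .add S T => max (S.height h) (T.height h) + 1

/-- The polynomial computed at the root, where `p` gives the polynomials computed in `V`. -/
noncomputable def eval {V : Type} (p : V → Poly) : SumTree V → Poly
  | .const c => C c
  | .odd _ v => p v
  | .even d i v => C (1 / (d : ℂ)) * (X i * p v)
  | .add S T => S.eval p + T.eval p

/-- Every summand is what the grading of `f` asks for: the constant is `f(0)`, the summand with
an odd index `d` is the degree-`d` component `f_d` of `f`, and the vertex in the summand with
index `(d, i)`, `d ≥ 2` even, computes `∂ f_d / ∂ x i`. -/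
def IsGradedFor {V : Type} (p : V → Poly) (f : Poly) : SumTree V → Prop
  | .const c => c = constantCoeff f
  | .odd d v => Odd d ∧ p v = homogeneousComponent d f
  | .even d i v => Even d ∧ 2 ≤ d ∧ p v = pderiv i (homogeneousComponent d f)
  | .add S T => S.IsGradedFor p f ∧ T.IsGradedFor p f

end SumTree

/-- A circuit of the shape
`f(0) + ∑_{d odd} f_d + ∑_{d ≥ 2 even} (1 / d) ∑_i x i * (∂ f_d / ∂ x i)`
whose blocks `f_d` and `∂ f_d / ∂ x i` are computed at vertices of an IHL circuit over the
arity-3 basis. The blocks may share gates. -/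
structure GradedCircuit : Type 1 where
  body : IHLCircuit
  top : SumTree body.V

namespace GradedCircuit

/-- The total number of vertices. -/
def size (G : GradedCircuit) : ℕ := G.body.size + G.top.size

/-- The length of a longest path from the root to a leaf. -/
noncomputable def depth (G : GradedCircuit) : ℕ := G.top.height G.body.height

/-- `G` is a graded circuit for `f`: its summands are the ones that the grading prescribes,
each occurs at most once, and the root computes `f`. (Hence only summands that vanish can be
missing.) -/
def Computes (G : GradedCircuit) (f : Poly) : Prop :=
  G.top.IsGradedFor G.body.eval f ∧
    G.top.consts.length ≤ 1 ∧ G.top.oddIndices.Nodup ∧ G.top.evenIndices.Nodup ∧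
    G.top.eval G.body.eval = f

/-- All gates of the IHL part compute homogeneous polynomials. -/
def IsHomogeneous (G : GradedCircuit) : Prop := G.body.IsHomogeneous

end GradedCircuit

end ArityThree

/-! This is the Valiant–Skyum–Berkowitz–Rackoff argument, adapted to ternary products. In a
homogeneous circuit let `[u : v]` be the cofactor of `v` in `u` obtained by always descending into
the factor of highest degree. A descent from degree above `m` crosses the threshold `m` at exactly
one product `t`, with factors `lo`, `mid`, `hi` sorted by degree. Hence `u = ∑ c_t [u : t] lo mid
hi` and, for `deg v ≤ m < deg u`, `[u : v] = ∑ c_t [u : t] lo mid [hi : v]`; both are instances of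
`eq_sum_frontier`.

The classical proof computes the quotients themselves. Here that is impossible: linear leaves and
ternary products yield only odd degrees, whereas a nonzero quotient has even degree; moreover the
terms above have four factors. Both obstacles disappear if the intermediate polynomials are the
products `[u : v] * w`. They include `w = [w : w] * w`, and every term regroups into a ternary
product of them. With thresholds chosen by halving, all factors have at most 5/6 of the total degree
(`expands_diag`, `expands_right`, `expands_left`), except `mid` in `expands_left`. That factor is
the polynomial of a vertex, so each round treats the vertices first and the other triples
afterwards.

With `N` vertices there are `O(log d)` rounds, each consisting of two layers of products under
balanced sums of at most `N` terms. This gives depth `O(log d log N)` and, over at most `N ^ 3`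
triples, size `O(N ^ 4)`. For a homogeneous circuit the system is the circuit itself. In general it
is the homogenization up to degree `d`, whose size is polynomial because `d ≤ s ^ k`. Finally the
outer sum is rebuilt as a balanced tree over its nonvanishing summands. -/

namespace ArityThree

open MvPolynomial

/-! ### Adding a gate to a circuit. -/

/-- Relabelling the children of a gate. -/
def Gate.map {V W : Type} (f : V → W) : Gate V → Gate W
  | .leaf l hl => .leaf l hl
  | .add a b u v => .add a b (f u) (f v)
  | .mul a b c u v w => .mul a b c (f u) (f v) (f w)

theorem Gate.children_map {V W : Type} (f : V → W) (g : Gate V) :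
    (g.map f).children = g.children.map f := by
  cases g <;> rfl

theorem Gate.value_map {V W : Type} (f : V → W) (g : Gate V) (p : W → Poly) :
    ((g.map f).value fun u _ => p u) = g.value fun u _ => p (f u) := by
  cases g <;> rfl

theorem Gate.height_map {V W : Type} (f : V → W) (g : Gate V) (p : W → ℕ) :
    ((g.map f).height fun u _ => p u) = g.height fun u _ => p (f u) := by
  cases g <;> rfl

namespace IHLCircuit

/-- The gates of `K` together with one further gate. -/
def extendGate (K : IHLCircuit) (g : Gate K.V) : Option K.V → Gate (Option K.V)
  | none => g.map some
  | some v => (K.gate v).map some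

/-- The circuit `K` with one further gate, which is the vertex `none`. -/
abbrev extend (K : IHLCircuit) (g : Gate K.V) : IHLCircuit where
  V := Option K.V
  fintypeV := @instFintypeOption _ K.fintypeV
  gate := K.extendGate g
  acyclic := by
    have hs : ∀ v : K.V,
        Acc (fun u v : Option K.V => u ∈ (K.extendGate g v).children) (some v) := by
      intro v
      induction v using K.acyclic.induction with
      | _ v ih =>
        refine ⟨_, fun u hu => ?_⟩
        simp only [extendGate, Gate.children_map, List.mem_map] at hu
        obtain ⟨w, hw, rfl⟩ := hu
        exact ih w hw
    refine ⟨fun v => ?_⟩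
    cases v with
    | some v => exact hs v
    | none =>
      refine ⟨_, fun u hu => ?_⟩
      simp only [extendGate, Gate.children_map, List.mem_map] at hu
      obtain ⟨w, -, rfl⟩ := hu
      exact hs w

theorem extend_size (K : IHLCircuit) (g : Gate K.V) : (K.extend g).size = K.size + 1 :=
  @Fintype.card_option K.V K.fintypeV

theorem extend_eval_some (K : IHLCircuit) (g : Gate K.V) (v : K.V) :
    (K.extend g).eval (some v) = K.eval v := by
  induction v using K.acyclic.induction with
  | _ v ih =>
    rw [eval_eq, K.eval_eq v]
    change (((K.gate v).map some).value fun u _ => (K.extend g).eval u) = _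
    rw [Gate.value_map]
    congr 1
    funext u hu
    exact ih u hu

theorem extend_eval_none (K : IHLCircuit) (g : Gate K.V) :
    (K.extend g).eval none = g.value fun u _ => K.eval u := by
  rw [eval_eq]
  change ((g.map some).value fun u _ => (K.extend g).eval u) = _
  rw [Gate.value_map]
  simp only [extend_eval_some]

theorem extend_height_some (K : IHLCircuit) (g : Gate K.V) (v : K.V) :
    (K.extend g).height (some v) = K.height v := by
  induction v using K.acyclic.induction with
  | _ v ih =>
    rw [height_eq, K.height_eq v]
    change (((K.gate v).map some).height fun u _ => (K.extend g).height u) = _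
    rw [Gate.height_map]
    congr 1
    funext u hu
    exact ih u hu

theorem extend_height_none (K : IHLCircuit) (g : Gate K.V) :
    (K.extend g).height none = g.height fun u _ => K.height u := by
  rw [height_eq]
  change ((g.map some).height fun u _ => (K.extend g).height u) = _
  rw [Gate.height_map]
  simp only [extend_height_some]

theorem IsHomogeneous.extend {K : IHLCircuit} (hK : K.IsHomogeneous) (g : Gate K.V) {n : ℕ}
    (hg : (g.value fun u _ => K.eval u).IsHomogeneous n) : (K.extend g).IsHomogeneous := by
  rintro (_ | v)
  · exact ⟨n, by rw [extend_eval_none]; exact hg⟩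
  · obtain ⟨m, hm⟩ := hK v
    exact ⟨m, by rw [extend_eval_some]; exact hm⟩

/-- Children are strictly lower than their parent. -/
theorem height_lt_of_mem_children (K : IHLCircuit) {u v : K.V} (h : u ∈ (K.gate v).children) :
    K.height u < K.height v := by
  rw [K.height_eq v]
  revert h
  cases K.gate v <;> simp only [Gate.children, Gate.height, List.mem_cons, List.not_mem_nil,
    or_false, false_imp_iff]
  · rintro (rfl | rfl) <;> omega
  · rintro (rfl | rfl | rfl) <;> omega

end IHLCircuit

/-! ### Sets of polynomials computed within given size and height. -/

/-- Some homogeneous circuit of size at most `n` computes, for every `(p, h)` in `T`, the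
polynomial `p` at a vertex of height at most `h`. -/
def Realizable (n : ℕ) (T : Set (Poly × ℕ)) : Prop :=
  ∃ K : IHLCircuit, K.IsHomogeneous ∧ K.size ≤ n ∧
    ∀ x ∈ T, ∃ v, K.eval v = x.1 ∧ K.height v ≤ x.2

namespace Realizable

variable {n : ℕ} {T : Set (Poly × ℕ)}

theorem empty : Realizable 0 ∅ :=
  ⟨⟨Empty, inferInstance, fun v => v.elim, ⟨fun v => v.elim⟩⟩, fun v => v.elim, le_rfl,
    fun _ hx => hx.elim⟩

theorem mono (h : Realizable n T) {m : ℕ} {T' : Set (Poly × ℕ)} (hnm : n ≤ m)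
    (hT : ∀ x ∈ T', ∃ k ≤ x.2, (x.1, k) ∈ T) : Realizable m T' := by
  obtain ⟨K, hK, hn, hr⟩ := h
  refine ⟨K, hK, hn.trans hnm, fun x hx => ?_⟩
  obtain ⟨k, hk, hkT⟩ := hT x hx
  obtain ⟨v, hv, hv'⟩ := hr _ hkT
  exact ⟨v, hv, hv'.trans hk⟩

theorem of_extend {K : IHLCircuit} (hK : K.IsHomogeneous) (hn : K.size ≤ n)
    (hr : ∀ x ∈ T, ∃ v, K.eval v = x.1 ∧ K.height v ≤ x.2) (g : Gate K.V) {d h : ℕ} {p : Poly}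
    (hp : (g.value fun u _ => K.eval u) = p) (hd : p.IsHomogeneous d)
    (hh : (g.height fun u _ => K.height u) ≤ h) : Realizable (n + 1) (insert (p, h) T) := by
  refine ⟨K.extend g, hK.extend g (hp ▸ hd), by rw [K.extend_size]; omega, ?_⟩
  rintro x (rfl | hx)
  · exact ⟨none, by rw [K.extend_eval_none]; exact hp, by rw [K.extend_height_none]; exact hh⟩
  · obtain ⟨v, hv, hv'⟩ := hr x hx
    exact ⟨some v, by rw [K.extend_eval_some]; exact hv, by rw [K.extend_height_some]; exact hv'⟩

theorem leaf (hT : Realizable n T) {l : Poly} (hl : l.IsHomogeneous 1) (h : ℕ) :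
    Realizable (n + 1) (insert (l, h) T) := by
  obtain ⟨K, hK, hn, hr⟩ := hT
  exact of_extend hK hn hr (.leaf l hl) rfl hl (Nat.zero_le _)

theorem add (hT : Realizable n T) {p q : Poly} {h d : ℕ} (hp : (p, h) ∈ T) (hq : (q, h) ∈ T)
    (hpd : p.IsHomogeneous d) (hqd : q.IsHomogeneous d) :
    Realizable (n + 1) (insert (p + q, h + 1) T) := by
  obtain ⟨K, hK, hn, hr⟩ := hT
  obtain ⟨u, hu, hu'⟩ := hr _ hp
  obtain ⟨v, hv, hv'⟩ := hr _ hq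
  refine of_extend hK hn hr (.add 1 1 u v) ?_ (hpd.add hqd) ?_
  · simp [Gate.value, hu, hv]
  · simp only [Gate.height]
    simp only at hu' hv'
    omega

theorem mul (hT : Realizable n T) {p q r : Poly} {h : ℕ} (c : ℂ) (hp : (p, h) ∈ T)
    (hq : (q, h) ∈ T) (hr : (r, h) ∈ T) :
    Realizable (n + 1) (insert (C c * (p * q * r), h + 1) T) := by
  obtain ⟨K, hK, hn, ht⟩ := hT
  obtain ⟨u, hu, hu'⟩ := ht _ hp
  obtain ⟨v, hv, hv'⟩ := ht _ hq
  obtain ⟨w, hw, hw'⟩ := ht _ hr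
  obtain ⟨a, ha⟩ := hK u
  obtain ⟨b, hb⟩ := hK v
  obtain ⟨e, he⟩ := hK w
  rw [hu] at ha
  rw [hv] at hb
  rw [hw] at he
  refine of_extend hK hn ht (.mul c 1 1 u v w) ?_
    ((isHomogeneous_C _ c).mul ((ha.mul hb).mul he)) ?_
  · simp only [Gate.value, hu, hv, hw, map_one]
    ring
  · simp only [Gate.height]
    simp only at hu' hv' hw'
    omega

theorem subset (hT : Realizable n T) {m : ℕ} {T' : Set (Poly × ℕ)} (hnm : n ≤ m)
    (h : T' ⊆ T) : Realizable m T' :=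
  hT.mono hnm fun x hx => ⟨x.2, le_rfl, h hx⟩

/-- Balanced binary summation. -/
theorem listSum (d k : ℕ) : ∀ (n h : ℕ) (T : Set (Poly × ℕ)) (l : List Poly), Realizable n T →
    l ≠ [] → l.length ≤ 2 ^ k → (∀ p ∈ l, p.IsHomogeneous d ∧ (p, h) ∈ T) →
    Realizable (n + (l.length - 1)) (insert (l.sum, h + k) T) := by
  induction k with
  | zero =>
    intro n h T l hT hne hl hp
    obtain ⟨p, rfl⟩ : ∃ p, l = [p] := List.length_eq_one_iff.mp (by
      have := List.length_pos_iff.mpr hne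
      simp at hl
      omega)
    refine hT.subset (by simp) ?_
    rintro x (rfl | hx)
    · simpa using (hp p (by simp)).2
    · exact hx
  | succ k ih =>
    intro n h T l hT hne hl hp
    by_cases hd : l.drop (2 ^ k) = []
    · refine (ih n h T l hT hne (by simpa using hd) hp).mono le_rfl ?_
      rintro x (rfl | hx)
      · exact ⟨h + k, by simp, by simp⟩
      · exact ⟨x.2, le_rfl, Or.inr hx⟩
    · have hlen : 2 ^ k < l.length := by simpa using hd
      have hpos : 0 < 2 ^ k := by positivity
      have h1 := ih n h T (l.take (2 ^ k)) hT
        (by intro h0; simp [List.take_eq_nil_iff] at h0; exact hne h0) (by simp)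
        (fun p hpl => hp p (List.mem_of_mem_take hpl))
      have h2 := ih _ h _ (l.drop (2 ^ k)) h1 hd (by simp; omega)
        (fun p hpl => ⟨(hp p (List.mem_of_mem_drop hpl)).1,
          Or.inr (hp p (List.mem_of_mem_drop hpl)).2⟩)
      have hom : ∀ l' : List Poly, (∀ p ∈ l', p ∈ l) → l'.sum.IsHomogeneous d := by
        intro l' hl'
        induction l' with
        | nil => simpa using isHomogeneous_zero _ _ _
        | cons p l' ih' =>
          rw [List.sum_cons]
          exact (hp p (hl' p (by simp))).1.add (ih' fun q hq => hl' q (by simp [hq]))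
      have h3 := h2.add (h := h + k) (p := (l.take (2 ^ k)).sum) (q := (l.drop (2 ^ k)).sum)
        (by simp) (by simp) (hom _ fun p => List.mem_of_mem_take)
        (hom _ fun p => List.mem_of_mem_drop)
      refine h3.subset (by simp; omega) ?_
      rw [List.sum_take_add_sum_drop]
      rintro x (rfl | hx)
      · exact Or.inl rfl
      · exact Or.inr (Or.inr (Or.inr hx))

/-- Adding a family of ternary products. -/
theorem products {ι : Type*} (hT : Realizable n T) (s : Finset ι) (c : ι → ℂ)
    (p q r : ι → Poly) (h : ℕ) (hs : ∀ i ∈ s, (p i, h) ∈ T ∧ (q i, h) ∈ T ∧ (r i, h) ∈ T) :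
    Realizable (n + s.card)
      (T ∪ (fun i => (C (c i) * (p i * q i * r i), h + 1)) '' (s : Set ι)) := by
  classical
  induction s using Finset.induction_on with
  | empty => simpa using hT
  | insert i s hi ih =>
    have h1 := ih fun j hj => hs j (Finset.mem_insert_of_mem hj)
    obtain ⟨a, b, e⟩ := hs i (Finset.mem_insert_self _ _)
    refine (h1.mul (c i) (Or.inl a) (Or.inl b) (Or.inl e)).subset
      (by rw [Finset.card_insert_of_notMem hi]; omega) ?_
    rw [Finset.coe_insert, Set.image_insert_eq, Set.union_insert]

/-- Adding a sum of ternary products. -/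
theorem sumProducts {ι : Type*} (hT : Realizable n T) (s : Finset ι) (c : ι → ℂ)
    (p q r : ι → Poly) (h d k : ℕ)
    (hs : ∀ i ∈ s, (p i, h) ∈ T ∧ (q i, h) ∈ T ∧ (r i, h) ∈ T)
    (hd : ∀ i ∈ s, (C (c i) * (p i * q i * r i)).IsHomogeneous d) (hk : s.card ≤ 2 ^ k) :
    Realizable (n + (2 * s.card + 1))
      (insert (∑ i ∈ s, C (c i) * (p i * q i * r i), h + 1 + k) T) := by
  rcases s.eq_empty_or_nonempty with rfl | hne
  -- The empty sum is the zero linear form, hence a leaf; this is the `+ 1` in the size.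
  · simpa using hT.leaf (isHomogeneous_zero _ _ 1) (h + 1 + k)
  · have h1 := listSum d k _ (h + 1) _
      (s.toList.map fun i => C (c i) * (p i * q i * r i)) (hT.products s c p q r h hs)
      (by simpa using hne.ne_empty) (by simpa using hk) (by
        intro P hP
        obtain ⟨i, hi, rfl⟩ := List.mem_map.mp hP
        rw [Finset.mem_toList] at hi
        exact ⟨hd i hi, Or.inr ⟨i, hi, rfl⟩⟩)
    rw [Finset.sum_map_toList] at h1
    refine h1.subset (by simp; omega) ?_
    exact Set.insert_subset_insert Set.subset_union_left

end Realizable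
-- Graded systems, quotients and frontiers.
/-- The ways in which a vertex of a graded system can arise: as a linear form, as a weighted sum
of vertices, or as a scaled ternary product. -/
inductive Rule (V : Type) : Type
  | lin : Rule V
  | sum (A : V → ℂ) : Rule V
  | prod (c : ℂ) (x y z : V) : Rule V

/-- The rule is correct at `v`. The factors of a product are sorted by degree; only the summands
and the factor of highest degree have to have smaller rank. -/
def Rule.Holds {V : Type} [Fintype V] (p : V → Poly) (deg rank : V → ℕ) (v : V) : Rule V → Prop
  | .lin => deg v = 1
  | .sum A => p v = ∑ u, C (A u) * p u ∧ ∀ u, A u ≠ 0 → rank u < rank v ∧ deg u = deg v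
  | .prod c x y z => p v = C c * (p x * p y * p z) ∧ deg v = deg x + deg y + deg z ∧
      deg x ≤ deg y ∧ deg y ≤ deg z ∧ rank z < rank v

/-- The scalar of a product. -/
def Rule.coef {V : Type} : Rule V → ℂ
  | .prod c _ _ _ => c
  | _ => 0

/-- The first factor of a product. -/
def Rule.fst {V : Type} (d : V) : Rule V → V
  | .prod _ x _ _ => x
  | _ => d

/-- The second factor of a product. -/
def Rule.snd {V : Type} (d : V) : Rule V → V
  | .prod _ _ y _ => y
  | _ => d

/-- The third factor of a product. -/
def Rule.thd {V : Type} (d : V) : Rule V → V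
  | .prod _ _ _ z => z
  | _ => d

/-- The rule is a product of degree more than `m` with factors of degree at most `m`. -/
def Rule.Crosses {V : Type} (deg : V → ℕ) (m : ℕ) (v : V) : Rule V → Prop
  | .prod _ _ _ z => m < deg v ∧ deg z ≤ m
  | _ => False

/-- A finite family of homogeneous polynomials of positive degrees in which each member is a
linear form, a weighted sum of others of the same degree, or a ternary product of others. -/
structure GradedSystem (V : Type) [Fintype V] where
  p : V → Poly
  deg : V → ℕ
  rank : V → ℕ
  rule : V → Rule V
  hom : ∀ v, (p v).IsHomogeneous (deg v)
  deg_pos : ∀ v, 0 < deg v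
  spec : ∀ v, (rule v).Holds p deg rank v

namespace GradedSystem

variable {V : Type} [Fintype V] (S : GradedSystem V)

open Classical in
/-- The quotient `[u : v]`: the cofactor of `v` in `u` along the factors of highest degree. -/
noncomputable def quot (v u : V) : Poly :=
  if u = v then 1 else
    match S.rule u with
    | .lin => 0
    | .sum A => ∑ w, if S.rank w < S.rank u then C (A w) * quot v w else 0
    | .prod c x y z => if S.rank z < S.rank u then C c * (S.p x * S.p y * quot v z) else 0
termination_by S.rank u

theorem quot_self (v : V) : S.quot v v = 1 := by
  rw [quot, if_pos rfl]

theorem quot_lin {u v : V} (h : u ≠ v) (hr : S.rule u = .lin) : S.quot v u = 0 := by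
  rw [quot, if_neg h, hr]

/-- The rank test in `quot` only secures termination: by `S.spec` the coefficients it excludes are
zero. -/
theorem quot_sum {u v : V} (h : u ≠ v) {A : V → ℂ} (hr : S.rule u = .sum A) :
    S.quot v u = ∑ w, C (A w) * S.quot v w := by
  rw [quot, if_neg h, hr]
  refine Finset.sum_congr rfl fun w _ => ?_
  have := S.spec u
  rw [hr] at this
  split_ifs with hw
  · rfl
  · have : A w = 0 := by
      by_contra h0
      exact hw (this.2 w h0).1
    simp [this]

theorem quot_prod {u v : V} (h : u ≠ v) {c : ℂ} {x y z : V} (hr : S.rule u = .prod c x y z) :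
    S.quot v u = C c * (S.p x * S.p y * S.quot v z) := by
  rw [quot, if_neg h, hr]
  have := S.spec u
  rw [hr] at this
  exact if_pos this.2.2.2.2

@[elab_as_elim]
theorem rank_induction {motive : V → Prop}
    (h : ∀ u, (∀ w, S.rank w < S.rank u → motive w) → motive u) (u : V) : motive u := by
  induction hn : S.rank u using Nat.strong_induction_on generalizing u with
  | _ n ih => exact h u fun w hw => ih _ (hn ▸ hw) w rfl

/-- The degree never rises along the descent from `u`, so a vertex of larger degree is never met. -/
theorem quot_eq_zero {u v : V} (h : S.deg u < S.deg v) : S.quot v u = 0 := by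
  revert h
  refine S.rank_induction ?_ u
  intro u ih h
  have hne : u ≠ v := by rintro rfl; omega
  have hs := S.spec u
  cases hr : S.rule u with
  | lin => exact S.quot_lin hne hr
  | sum A =>
    rw [hr] at hs
    rw [S.quot_sum hne hr]
    refine Finset.sum_eq_zero fun w _ => ?_
    by_cases hA : A w = 0
    · simp [hA]
    · obtain ⟨h1, h2⟩ := hs.2 w hA
      rw [ih w h1 (by omega), mul_zero]
  | prod c x y z =>
    rw [hr] at hs
    obtain ⟨-, h1, -, -, h2⟩ := hs
    rw [S.quot_prod hne hr, ih z h2 (by omega), mul_zero, mul_zero]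

theorem quot_isHomogeneous {u v : V} (h : S.deg v ≤ S.deg u) :
    (S.quot v u).IsHomogeneous (S.deg u - S.deg v) := by
  revert h
  refine S.rank_induction ?_ u
  intro u ih h
  by_cases hne : u = v
  · subst hne
    rw [quot_self, Nat.sub_self]
    exact isHomogeneous_one _ _
  have hs := S.spec u
  cases hr : S.rule u with
  | lin =>
    rw [S.quot_lin hne hr]
    exact isHomogeneous_zero _ _ _
  | sum A =>
    rw [hr] at hs
    rw [S.quot_sum hne hr]
    refine IsHomogeneous.sum _ _ _ fun w _ => ?_
    by_cases hA : A w = 0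
    · simpa [hA] using isHomogeneous_zero _ _ _
    · obtain ⟨h1, h2⟩ := hs.2 w hA
      have := (isHomogeneous_C ℕ (A w)).mul (ih w h1 (by omega))
      rwa [zero_add, h2] at this
  | prod c x y z =>
    rw [hr] at hs
    obtain ⟨-, h1, -, -, h2⟩ := hs
    rw [S.quot_prod hne hr]
    by_cases hz : S.deg z < S.deg v
    · rw [S.quot_eq_zero hz, mul_zero, mul_zero]
      exact isHomogeneous_zero _ _ _
    · have := (isHomogeneous_C ℕ c).mul
        (((S.hom x).mul (S.hom y)).mul (ih z h2 (by omega)))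
      convert this using 1
      omega

open Classical in
/-- The products at which the degree drops from above `m` to at most `m`. -/
noncomputable def frontier (m : ℕ) : Finset V :=
  Finset.univ.filter fun t => (S.rule t).Crosses S.deg m t

/-- The scalar of the product at `t`. -/
def coef (t : V) : ℂ := (S.rule t).coef

/-- The factor of lowest degree of the product at `t`. -/
def lo (t : V) : V := (S.rule t).fst t

/-- The factor of middle degree of the product at `t`. -/
def mid (t : V) : V := (S.rule t).snd t

/-- The factor of highest degree of the product at `t`. -/
def hi (t : V) : V := (S.rule t).thd t

theorem frontier_spec {m : ℕ} {t : V} (h : t ∈ S.frontier m) :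
    S.rule t = .prod (S.coef t) (S.lo t) (S.mid t) (S.hi t) ∧ m < S.deg t ∧
      S.deg (S.hi t) ≤ m ∧ S.deg t = S.deg (S.lo t) + S.deg (S.mid t) + S.deg (S.hi t) ∧
      S.deg (S.lo t) ≤ S.deg (S.mid t) ∧ S.deg (S.mid t) ≤ S.deg (S.hi t) := by
  classical
  have h1 := (Finset.mem_filter.mp h).2
  have h2 := S.spec t
  simp only [coef, lo, mid, hi]
  cases hr : S.rule t with
  | lin => rw [hr] at h1; exact h1.elim
  | sum A => rw [hr] at h1; exact h1.elim
  | prod c x y z =>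
    rw [hr] at h1 h2
    exact ⟨rfl, h1.1, h1.2, h2.2.1, h2.2.2.1, h2.2.2.2.1⟩

/-- A function that propagates along the factors of highest degree is determined by its values
on a frontier. -/
theorem eq_sum_frontier (φ : V → Poly) {m : ℕ} (hm : 1 ≤ m)
    (hsum : ∀ u A, m < S.deg u → S.rule u = .sum A → φ u = ∑ w, C (A w) * φ w)
    (hprod : ∀ u c x y z, m < S.deg u → S.rule u = .prod c x y z →
      φ u = C c * (S.p x * S.p y * φ z)) (u : V) (hu : m < S.deg u) :
    φ u = ∑ t ∈ S.frontier m, S.quot t u * φ t := by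
  classical
  revert hu
  refine S.rank_induction ?_ u
  intro u ih hu
  have hs := S.spec u
  cases hr : S.rule u with
  | lin =>
    rw [hr] at hs
    have : S.deg u = 1 := hs
    omega
  | sum A =>
    rw [hr] at hs
    -- Frontier elements are products, so each quotient at a sum vertex unfolds linearly.
    have hu' : ∀ t ∈ S.frontier m, u ≠ t := by
      rintro t ht rfl
      have := (S.frontier_spec ht).1
      rw [hr] at this
      cases this
    rw [hsum u A hu hr]
    calc ∑ w, C (A w) * φ w
        = ∑ w, ∑ t ∈ S.frontier m, C (A w) * (S.quot t w * φ t) := by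
          refine Finset.sum_congr rfl fun w _ => ?_
          by_cases hA : A w = 0
          · simp [hA]
          · obtain ⟨h1, h2⟩ := hs.2 w hA
            rw [← Finset.mul_sum, ← ih w h1 (by omega)]
      _ = ∑ t ∈ S.frontier m, S.quot t u * φ t := by
          rw [Finset.sum_comm]
          refine Finset.sum_congr rfl fun t ht => ?_
          rw [S.quot_sum (hu' t ht) hr, Finset.sum_mul]
          exact Finset.sum_congr rfl fun w _ => by ring
  | prod c x y z =>
    rw [hr] at hs
    by_cases hz : S.deg z ≤ m
    -- The crossing happens at `u` itself; for any other `t` the descent continues below the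
    -- threshold, where `[z : t] = 0`.
    · have hmem : u ∈ S.frontier m := by
        rw [frontier, Finset.mem_filter, hr]
        exact ⟨Finset.mem_univ _, hu, hz⟩
      rw [Finset.sum_eq_single_of_mem u hmem, S.quot_self, one_mul]
      intro t ht htu
      rw [S.quot_prod (Ne.symm htu) hr, S.quot_eq_zero (lt_of_le_of_lt hz (S.frontier_spec ht).2.1)]
      ring
    · rw [hprod u c x y z hu hr, ih z hs.2.2.2.2 (by omega), Finset.mul_sum, Finset.mul_sum]
      refine Finset.sum_congr rfl fun t ht => ?_
      have hne : u ≠ t := by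
        rintro rfl
        have h1 := S.frontier_spec ht
        have h2 := h1.1
        rw [hr] at h2
        injection h2 with _ _ _ h3
        rw [← h3] at h1
        omega
      rw [S.quot_prod hne hr]
      ring

theorem p_eq_sum_frontier {m : ℕ} (hm : 1 ≤ m) {u : V} (hu : m < S.deg u) :
    S.p u = ∑ t ∈ S.frontier m,
      S.quot t u * (C (S.coef t) * (S.p (S.lo t) * S.p (S.mid t) * S.p (S.hi t))) := by
  have hp : ∀ u c x y z, S.rule u = .prod c x y z → S.p u = C c * (S.p x * S.p y * S.p z) := by
    intro u c x y z hr
    have := S.spec u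
    rw [hr] at this
    exact this.1
  rw [S.eq_sum_frontier S.p hm ?_ (fun u c x y z _ => hp u c x y z) u hu]
  · exact Finset.sum_congr rfl fun t ht => by
      rw [← hp _ _ _ _ _ (S.frontier_spec ht).1]
  · intro u A _ hr
    have := S.spec u
    rw [hr] at this
    exact this.1

/-- Since `deg v ≤ m`, no vertex above the threshold equals `v`, so there `[· : v]` obeys the same
recursion as `S.p`. -/
theorem quot_eq_sum_frontier {m : ℕ} {u v : V} (hv : S.deg v ≤ m) (hu : m < S.deg u) :
    S.quot v u = ∑ t ∈ S.frontier m,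
      S.quot t u * (C (S.coef t) * (S.p (S.lo t) * S.p (S.mid t) * S.quot v (S.hi t))) := by
  have hne : ∀ u, m < S.deg u → u ≠ v := by
    rintro u h rfl
    omega
  rw [S.eq_sum_frontier (S.quot v) ((S.deg_pos v).trans_le hv)
    (fun u A h => S.quot_sum (hne u h)) (fun u c x y z h => S.quot_prod (hne u h)) u hu]
  refine Finset.sum_congr rfl fun t ht => ?_
  have h1 := S.frontier_spec ht
  rw [S.quot_prod (hne t h1.2.1) h1.1]

/-! ### Expansions into ternary products of smaller degree. -/

/-- The polynomial `[u : v] * w` attached to `(u, v, w)`. -/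
noncomputable def P (i : V × V × V) : Poly := S.quot i.2.1 i.1 * S.p i.2.2

/-- The degree of `S.P i`. -/
def dP (i : V × V × V) : ℕ := S.deg i.1 - S.deg i.2.1 + S.deg i.2.2

/-- The triples for which `S.P i` does not vanish for reasons of degree. -/
def Valid (i : V × V × V) : Prop := S.deg i.2.1 ≤ S.deg i.1

theorem P_isHomogeneous {i : V × V × V} (h : S.Valid i) : (S.P i).IsHomogeneous (S.dP i) :=
  (S.quot_isHomogeneous h).mul (S.hom _)

theorem P_diag (w : V) : S.P (w, w, w) = S.p w := by
  simp [P, quot_self]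

theorem dP_diag (w : V) : S.dP (w, w, w) = S.deg w := by
  simp [dP]

/-- `S.P i` is a sum of ternary products of matching degrees of valid polynomials `S.P j` with
`good j`. -/
def Expands (i : V × V × V) (good : V × V × V → Prop) : Prop :=
  ∃ (s : Finset V) (c : V → ℂ) (j k l : V → V × V × V),
    S.P i = ∑ t ∈ s, C (c t) * (S.P (j t) * S.P (k t) * S.P (l t)) ∧
    ∀ t ∈ s, (S.Valid (j t) ∧ good (j t)) ∧ (S.Valid (k t) ∧ good (k t)) ∧
      (S.Valid (l t) ∧ good (l t)) ∧ S.dP (j t) + S.dP (k t) + S.dP (l t) = S.dP i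

/-- Group the terms as `([w : t] lo) · mid · hi`. The last two factors have degree at most half of
`deg w`. The first has degree `deg w - mid - hi`, and `mid + hi` is at least two thirds of `deg t >
deg w / 2`. -/
theorem expands_diag {w : V} (hw : 2 ≤ S.deg w) :
    S.Expands (w, w, w) fun j => 6 * S.dP j ≤ 5 * S.deg w := by
  classical
  -- Terms with `deg t > deg w` vanish; they are removed because truncated subtraction would falsify
  -- their `dP`.
  refine ⟨(S.frontier (S.deg w / 2)).filter fun t => S.deg t ≤ S.deg w, S.coef,
    fun t => (w, t, S.lo t), fun t => (S.mid t, S.mid t, S.mid t),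
    fun t => (S.hi t, S.hi t, S.hi t), ?_, ?_⟩
  · simp only [P_diag]
    rw [S.p_eq_sum_frontier (m := S.deg w / 2) (by omega) (by omega), Finset.sum_filter]
    refine Finset.sum_congr rfl fun t _ => ?_
    split_ifs with h
    · simp only [P]
      ring
    · rw [S.quot_eq_zero (by omega), zero_mul]
  · intro t ht
    obtain ⟨ht, h0⟩ := Finset.mem_filter.mp ht
    obtain ⟨-, h1, h2, h3, h4, h5⟩ := S.frontier_spec ht
    simp only [Valid, dP]
    omega

/-- Expand `w`, which carries at least a quarter of the total degree `D`, and group as `([u : v] lo)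
· hi · ([w : t] mid)`. As `lo` is at most a third of `deg w`, the first factor loses at least `2/3 ·
D/4 = D/6`; this is the source of the ratio 5/6. -/
theorem expands_right {u v w : V} (hv : S.deg v ≤ S.deg u) (hw : 2 ≤ S.deg w)
    (h : S.deg u - S.deg v + S.deg w ≤ 4 * S.deg w) :
    S.Expands (u, v, w) fun j => 6 * S.dP j ≤ 5 * S.dP (u, v, w) := by
  classical
  refine ⟨(S.frontier (S.deg w / 2)).filter fun t => S.deg t ≤ S.deg w, S.coef,
    fun t => (u, v, S.lo t), fun t => (S.hi t, S.hi t, S.hi t),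
    fun t => (w, t, S.mid t), ?_, ?_⟩
  · simp only [P_diag]
    rw [P, S.p_eq_sum_frontier (m := S.deg w / 2) (by omega) (by simp only; omega),
      Finset.sum_filter, Finset.mul_sum]
    refine Finset.sum_congr rfl fun t _ => ?_
    split_ifs with h
    · simp only [P]
      ring
    · rw [S.quot_eq_zero (u := w) (v := t) (by omega), zero_mul, mul_zero]
  · intro t ht
    obtain ⟨ht, h0⟩ := Finset.mem_filter.mp ht
    obtain ⟨-, h1, h2, h3, h4, h5⟩ := S.frontier_spec ht
    simp only [Valid, dP]
    omega

/-- Expand the quotient midway between `deg v` and `deg u`, and group as `([u : t] lo) · mid · ([hi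
: v] w)`. The outer factors shrink because `w` is small and `lo ≤ mid`. The factor `mid` may take up
almost the whole degree, but it is the polynomial of a vertex. -/
theorem expands_left {u v w : V} (hv : S.deg v < S.deg u)
    (h : S.deg w = 1 ∨ 4 * S.deg w < S.deg u - S.deg v + S.deg w) :
    S.Expands (u, v, w) fun j => 6 * S.dP j ≤ 5 * S.dP (u, v, w) ∨
      ∃ y, j = (y, y, y) ∧ S.dP j ≤ S.dP (u, v, w) := by
  classical
  refine ⟨(S.frontier (S.deg v + (S.deg u - S.deg v) / 2)).filter fun t =>
      S.deg t ≤ S.deg u ∧ S.deg v ≤ S.deg (S.hi t), S.coef,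
    fun t => (u, t, S.lo t), fun t => (S.mid t, S.mid t, S.mid t),
    fun t => (S.hi t, v, w), ?_, ?_⟩
  · simp only [P_diag]
    rw [P, S.quot_eq_sum_frontier (m := S.deg v + (S.deg u - S.deg v) / 2) (by simp only; omega)
      (by simp only; omega), Finset.sum_filter, Finset.sum_mul]
    refine Finset.sum_congr rfl fun t _ => ?_
    split_ifs with h
    · simp only [P]
      ring
    · rcases not_and_or.mp h with h | h
      · rw [S.quot_eq_zero (by simp only; omega), zero_mul, zero_mul]
      · rw [S.quot_eq_zero (u := S.hi t) (by simp only; omega)]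
        ring
  · intro t ht
    obtain ⟨ht, h0, h0'⟩ := Finset.mem_filter.mp ht
    obtain ⟨-, h1, h2, h3, h4, h5⟩ := S.frontier_spec ht
    have hw := S.deg_pos w
    have hx := S.deg_pos (S.lo t)
    refine ⟨⟨?_, Or.inl ?_⟩, ⟨?_, Or.inr ⟨_, rfl, ?_⟩⟩, ⟨?_, Or.inl ?_⟩, ?_⟩ <;>
      simp only [Valid, dP] <;> omega

end GradedSystem
-- Evaluation by levels of degree.
namespace GradedSystem

variable {V : Type} [Fintype V] (S : GradedSystem V)

/-- The polynomials `S.P i` for `i` in `I`, to be computed at height at most `h`. -/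
def targets (I : Finset (V × V × V)) (h : ℕ) : Set (Poly × ℕ) :=
  (fun i => (S.P i, h)) '' (I : Set (V × V × V))

/-- A new triple costs at most `N` products, `N` additions and a possible zero leaf; the height
grows by one product and a balanced sum. -/
theorem realizable_grow {I J : Finset (V × V × V)} (hIJ : I ⊆ J) {h k : ℕ}
    (hk : Fintype.card V ≤ 2 ^ k)
    (hI : Realizable ((2 * Fintype.card V + 1) * I.card) (S.targets I h))
    (hJ : ∀ i ∈ J, i ∉ I → S.Valid i ∧ S.Expands i (· ∈ I)) :
    Realizable ((2 * Fintype.card V + 1) * J.card) (S.targets J (h + 1 + k)) := by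
  classical
  -- Triples are added one at a time, but their products read only from `I`, so heights do not
  -- accumulate.
  have key : ∀ D : Finset (V × V × V), D ⊆ J \ I →
      Realizable ((2 * Fintype.card V + 1) * (I.card + D.card))
        (S.targets I h ∪ S.targets D (h + 1 + k)) := by
    intro D
    induction D using Finset.induction_on with
    | empty =>
      intro _
      simpa [targets] using hI
    | insert i D hi ih =>
      intro hD
      have hiD := Finset.mem_sdiff.mp (hD (Finset.mem_insert_self i D))
      obtain ⟨hv, s, c, a, b, e, hP, hs⟩ := hJ i hiD.1 hiD.2
      have mem : ∀ j ∈ I, (S.P j, h) ∈ S.targets I h ∪ S.targets D (h + 1 + k) :=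
        fun j hj => Or.inl ⟨j, hj, rfl⟩
      have h1 := (ih ((Finset.subset_insert i D).trans hD)).sumProducts s c
        (fun t => S.P (a t)) (fun t => S.P (b t)) (fun t => S.P (e t)) h (S.dP i) k
        (fun t ht => ⟨mem _ (hs t ht).1.2, mem _ (hs t ht).2.1.2, mem _ (hs t ht).2.2.1.2⟩)
        (fun t ht => by
          obtain ⟨⟨h1, -⟩, ⟨h2, -⟩, ⟨h3, -⟩, h4⟩ := hs t ht
          rw [← h4, ← zero_add (_ + _ + _)]
          exact (isHomogeneous_C _ _).mul (((S.P_isHomogeneous h1).mul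
            (S.P_isHomogeneous h2)).mul (S.P_isHomogeneous h3)))
        ((Finset.card_le_univ s).trans hk)
      rw [← hP] at h1
      refine h1.subset ?_ ?_
      · rw [Finset.card_insert_of_notMem hi]
        have := Finset.card_le_univ s
        nlinarith
      · rw [targets, targets, Finset.coe_insert, Set.image_insert_eq, Set.union_insert]
        rfl
  refine (key (J \ I) le_rfl).mono ?_ ?_
  · rw [add_comm I.card, Finset.card_sdiff_add_card_eq_card hIJ]
  · rintro x ⟨i, hi, rfl⟩
    by_cases hiI : i ∈ I
    · exact ⟨h, by simp only; omega, Or.inl ⟨i, hiI, rfl⟩⟩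
    · exact ⟨_, le_rfl, Or.inr ⟨i, by simpa using ⟨hi, hiI⟩, rfl⟩⟩

open Classical in
/-- The valid triples of degree at most `(6 / 5) ^ n`. -/
noncomputable def level (n : ℕ) : Finset (V × V × V) :=
  Finset.univ.filter fun i => S.Valid i ∧ 5 ^ n * S.dP i ≤ 6 ^ n

theorem mem_level {n : ℕ} {i : V × V × V} :
    i ∈ S.level n ↔ S.Valid i ∧ 5 ^ n * S.dP i ≤ 6 ^ n := by
  classical
  simp [level]

theorem level_mono (n : ℕ) : S.level n ⊆ S.level (n + 1) := by
  intro i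
  rw [mem_level, mem_level, pow_succ, pow_succ]
  rintro ⟨h1, h2⟩
  exact ⟨h1, by linarith [Nat.zero_le (5 ^ n * S.dP i)]⟩

theorem mem_level_of_dP_le_one {n : ℕ} {i : V × V × V} (hv : S.Valid i) (h : S.dP i ≤ 1) :
    i ∈ S.level n := by
  refine S.mem_level.mpr ⟨hv, ?_⟩
  calc 5 ^ n * S.dP i ≤ 5 ^ n * 1 := Nat.mul_le_mul_left _ h
    _ ≤ 6 ^ n := by
      rw [mul_one]
      exact Nat.pow_le_pow_left (by norm_num) n

theorem mem_level_of_mem_succ {n D : ℕ} {j : V × V × V} (hj : S.Valid j)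
    (hD : 5 ^ (n + 1) * D ≤ 6 ^ (n + 1)) (h : 6 * S.dP j ≤ 5 * D) : j ∈ S.level n := by
  refine S.mem_level.mpr ⟨hj, ?_⟩
  have h1 : 5 ^ n * (6 * S.dP j) ≤ 5 ^ n * (5 * D) := Nat.mul_le_mul_left _ h
  rw [pow_succ, pow_succ] at hD
  linarith

theorem Expands.mono {i : V × V × V} {g g' : V × V × V → Prop} (h : S.Expands i g)
    (hg : ∀ j, S.Valid j → g j → g' j) : S.Expands i g' := by
  obtain ⟨s, c, a, b, e, hP, hs⟩ := h
  refine ⟨s, c, a, b, e, hP, fun t ht => ?_⟩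
  obtain ⟨⟨h1, h1'⟩, ⟨h2, h2'⟩, ⟨h3, h3'⟩, h4⟩ := hs t ht
  exact ⟨⟨h1, hg _ h1 h1'⟩, ⟨h2, hg _ h2 h2'⟩, ⟨h3, hg _ h3 h3'⟩, h4⟩

/-- Positivity of `deg` forces degree exactly one here, so every member is a leaf. -/
theorem realizable_level_zero :
    Realizable ((2 * Fintype.card V + 1) * (S.level 0).card) (S.targets (S.level 0) 0) := by
  classical
  have key : ∀ D : Finset (V × V × V), D ⊆ S.level 0 →
      Realizable D.card (S.targets D 0) := by
    intro D
    induction D using Finset.induction_on with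
    | empty =>
      intro _
      simpa [targets] using Realizable.empty
    | insert i D hi ih =>
      intro hD
      obtain ⟨hv, hd⟩ := S.mem_level.mp (hD (Finset.mem_insert_self i D))
      have hw := S.deg_pos i.2.2
      have h1 : S.dP i = 1 := by
        simp only [pow_zero, one_mul] at hd
        simp only [dP] at hd ⊢
        omega
      have h2 := (ih ((Finset.subset_insert i D).trans hD)).leaf
        (h1 ▸ S.P_isHomogeneous hv) 0
      rw [Finset.card_insert_of_notMem hi, targets, Finset.coe_insert, Set.image_insert_eq]
      exact h2
  refine (key _ le_rfl).subset ?_ le_rfl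
  nlinarith

theorem realizable_level {k : ℕ} (hk : Fintype.card V ≤ 2 ^ k) (n : ℕ) :
    Realizable ((2 * Fintype.card V + 1) * (S.level n).card)
      (S.targets (S.level n) (n * (2 * (1 + k)))) := by
  classical
  induction n with
  | zero => simpa using S.realizable_level_zero
  | succ n ih =>
    -- First half of the round: the diagonal triples of the new level, available afterwards as the
    -- factor `mid` of `expands_left`.
    set J := S.level n ∪ (S.level (n + 1)).filter fun i => ∃ y, i = (y, y, y) with hJ
    have hJ2 : J ⊆ S.level (n + 1) :=
      Finset.union_subset (S.level_mono n) (Finset.filter_subset _ _)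
    have h1 := S.realizable_grow (J := J) Finset.subset_union_left hk ih (by
      intro i hi hin
      rcases Finset.mem_union.mp hi with h | h
      · exact absurd h hin
      obtain ⟨h2, w, rfl⟩ := Finset.mem_filter.mp h
      obtain ⟨h3, h4⟩ := S.mem_level.mp h2
      refine ⟨h3, Expands.mono S (S.expands_diag (w := w) ?_) ?_⟩
      · by_contra hw
        exact hin (S.mem_level_of_dP_le_one h3 (by rw [dP_diag]; omega))
      · intro j hj hj'
        rw [dP_diag] at h4
        exact S.mem_level_of_mem_succ hj h4 hj')
    have h2 := S.realizable_grow (J := S.level (n + 1)) hJ2 hk h1 (by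
      rintro ⟨u, v, w⟩ hi hiJ
      have hin : (u, v, w) ∉ S.level n := fun h => hiJ (Finset.mem_union_left _ h)
      obtain ⟨h3, h4⟩ := S.mem_level.mp hi
      have hlow : ∀ j, S.Valid j → 6 * S.dP j ≤ 5 * S.dP (u, v, w) → j ∈ J := fun j hj hj' =>
        Finset.mem_union_left _ (S.mem_level_of_mem_succ hj h4 hj')
      refine ⟨h3, ?_⟩
      have h3' : S.deg v ≤ S.deg u := h3
      -- Expand whichever part carries enough degree; a linear `w` leaves only the quotient.
      by_cases hw : 2 ≤ S.deg w ∧ S.deg u - S.deg v + S.deg w ≤ 4 * S.deg w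
      · exact Expands.mono S (S.expands_right h3' hw.1 hw.2) hlow
      · have hpos := S.deg_pos w
        -- For equal degrees the total is `deg w`, so the failed test means `deg w = 1`; such
        -- triples lie in every level.
        have hlt : S.deg v < S.deg u := by
          by_contra hge
          refine hin (S.mem_level_of_dP_le_one h3 ?_)
          simp only [dP]
          omega
        refine Expands.mono S (S.expands_left (w := w) hlt (by omega)) ?_
        rintro j hj (h5 | ⟨y, rfl, h5⟩)
        · exact hlow j hj h5
        · refine Finset.mem_union_right _ (Finset.mem_filter.mpr ⟨?_, y, rfl⟩)
          exact S.mem_level.mpr ⟨hj, (Nat.mul_le_mul_left _ h5).trans h4⟩)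
    refine h2.mono le_rfl fun x hx => ?_
    obtain ⟨i, hi, rfl⟩ := hx
    exact ⟨_, by simp only; linarith, ⟨i, hi, rfl⟩⟩

/-- Depth reduction: all members of degree at most `(6 / 5) ^ n` are computed in depth
`O(n log N)` by a circuit of size `O(N ^ 4)`. -/
theorem realizable {k : ℕ} (hk : Fintype.card V ≤ 2 ^ k) (n : ℕ) :
    Realizable (3 * Fintype.card V ^ 4)
      {x | ∃ v, 5 ^ n * S.deg v ≤ 6 ^ n ∧ x = (S.p v, n * (2 * (1 + k)))} := by
  classical
  rcases isEmpty_or_nonempty V with hV | hV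
  · exact Realizable.empty.mono (Nat.zero_le _) fun x ⟨v, _⟩ => (hV.false v).elim
  refine (S.realizable_level hk n).subset ?_ ?_
  · have h1 : (S.level n).card ≤ Fintype.card V ^ 3 := by
      refine (Finset.card_le_univ _).trans ?_
      rw [Fintype.card_prod, Fintype.card_prod]
      exact (by ring : _ = Fintype.card V ^ 3).le
    have h2 : 0 < Fintype.card V := Fintype.card_pos
    calc (2 * Fintype.card V + 1) * (S.level n).card
        ≤ (3 * Fintype.card V) * Fintype.card V ^ 3 := Nat.mul_le_mul (by omega) h1
      _ = 3 * Fintype.card V ^ 4 := by ring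
  · rintro x ⟨v, hv, rfl⟩
    refine ⟨(v, v, v), ?_, ?_⟩
    · rw [Finset.mem_coe, mem_level, dP_diag]
      exact ⟨le_rfl, hv⟩
    · simp only [P_diag]

end GradedSystem
-- A homogeneous circuit as a graded system.
theorem Rule.exists_holds_prod {V : Type} [Fintype V] {p : V → Poly} {deg rank : V → ℕ} {v : V}
    (c : ℂ) (x y z : V) (hp : p v = C c * (p x * p y * p z))
    (hd : deg v = deg x + deg y + deg z) (hx : rank x < rank v) (hy : rank y < rank v)
    (hz : rank z < rank v) : ∃ r : Rule V, r.Holds p deg rank v := by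
  rcases le_total (deg x) (deg y) with h1 | h1 <;> rcases le_total (deg y) (deg z) with h2 | h2 <;>
    rcases le_total (deg x) (deg z) with h3 | h3
  · exact ⟨.prod c x y z, by rw [hp], by omega, h1, h2, hz⟩
  · exact ⟨.prod c x y z, by rw [hp], by omega, h1, h2, hz⟩
  · exact ⟨.prod c x z y, by rw [hp]; ring, by omega, h3, h2, hy⟩
  · exact ⟨.prod c z x y, by rw [hp]; ring, by omega, h3, h1, hy⟩
  · exact ⟨.prod c y x z, by rw [hp]; ring, by omega, h1, h3, hz⟩
  · exact ⟨.prod c y z x, by rw [hp]; ring, by omega, h2, h3, hx⟩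
  · exact ⟨.prod c z y x, by rw [hp]; ring, by omega, h2, h1, hx⟩
  · exact ⟨.prod c z y x, by rw [hp]; ring, by omega, h2, h1, hx⟩

theorem homogeneousComponent_of_isHomogeneous {p : Poly} {m : ℕ} (h : p.IsHomogeneous m) (n : ℕ) :
    homogeneousComponent n p = if m = n then p else 0 := by
  rw [homogeneousComponent_of_mem ((mem_homogeneousSubmodule m p).mpr h)]
  simp only [eq_comm]

theorem sum_C_ite_mul {V : Type} [Fintype V] [DecidableEq V] (P : V → Prop) [DecidablePred P]
    (a b : ℂ) (x y : V) (φ : V → Poly) :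
    ∑ w, C (if P w then (if w = x then a else 0) + (if w = y then b else 0) else 0) * φ w =
      C a * (if P x then φ x else 0) + C b * (if P y then φ y else 0) := by
  have h : ∀ w, C (if P w then (if w = x then a else 0) + (if w = y then b else 0) else 0) * φ w =
      (if w = x then C a * (if P w then φ w else 0) else 0) +
        (if w = y then C b * (if P w then φ w else 0) else 0) := by
    intro w
    by_cases hP : P w
    · simp only [if_pos hP, map_add, add_mul, apply_ite C, map_zero, ite_mul, zero_mul]
    · simp [hP]
  simp only [h]
  rw [Finset.sum_add_distrib, Finset.sum_ite_eq' Finset.univ x,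
    Finset.sum_ite_eq' Finset.univ y, if_pos (Finset.mem_univ _), if_pos (Finset.mem_univ _)]

namespace IHLCircuit

variable (K : IHLCircuit)

/-- Leaves have no constant term, and gates preserve this. It is the reason why nonzero homogeneous
values have positive degree. -/
theorem constantCoeff_eval (v : K.V) : constantCoeff (K.eval v) = 0 := by
  induction v using K.acyclic.induction with
  | _ v ih =>
    rw [K.eval_eq v]
    revert ih
    cases K.gate v with
    | leaf l hl =>
      intro _
      simp only [Gate.value]
      rw [constantCoeff_eq, hl.coeff_eq_zero]
      simp
    | add a b u w =>
      intro ih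
      simp [Gate.value, ih u (by simp [Gate.children]), ih w (by simp [Gate.children])]
    | mul a b c u w x =>
      intro ih
      simp [Gate.value, ih u (by simp [Gate.children])]

theorem pos_of_isHomogeneous_eval {v : K.V} {n : ℕ} (h : (K.eval v).IsHomogeneous n)
    (h0 : K.eval v ≠ 0) : 0 < n := by
  rcases Nat.eq_zero_or_pos n with rfl | hn
  · refine absurd ?_ h0
    have h1 := K.constantCoeff_eval v
    rw [(totalDegree_eq_zero_iff_eq_C (p := K.eval v)).mp (h.totalDegree h0)] at h1 ⊢
    simp only [constantCoeff_C] at h1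
    rw [h1, map_zero]
  · exact hn

open Classical in
/-- The degree of a vertex of a homogeneous circuit, read as `1` for vanishing polynomials. -/
noncomputable def deg (v : K.V) : ℕ := if K.eval v = 0 then 1 else (K.eval v).totalDegree

variable {K}

theorem IsHomogeneous.deg (hK : K.IsHomogeneous) (v : K.V) :
    (K.eval v).IsHomogeneous (K.deg v) := by
  unfold IHLCircuit.deg
  split_ifs with h
  · rw [h]
    exact isHomogeneous_zero _ _ _
  · obtain ⟨n, hn⟩ := hK v
    rwa [hn.totalDegree h]

theorem deg_eq {v : K.V} {n : ℕ} (h : (K.eval v).IsHomogeneous n) (h0 : K.eval v ≠ 0) :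
    K.deg v = n := by
  rw [deg, if_neg h0, h.totalDegree h0]

theorem IsHomogeneous.exists_rule [Fintype K.V] (hK : K.IsHomogeneous) (v : K.V) :
    ∃ r : Rule K.V, r.Holds K.eval K.deg K.height v := by
  classical
  by_cases h0 : K.eval v = 0
  -- Zero counts as a linear form, matching the convention of `IHLCircuit.deg`.
  · exact ⟨.lin, by simp [Rule.Holds, IHLCircuit.deg, h0]⟩
  have hv := K.eval_eq v
  have hlt := fun u => K.height_lt_of_mem_children (u := u) (v := v)
  revert hv hlt
  cases K.gate v with
  | leaf l hl =>
    intro hv _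
    exact ⟨.lin, deg_eq (by rw [hv]; exact hl) h0⟩
  | add a b x y =>
    intro hv hlt
    simp only [Gate.value] at hv
    -- Summands of another degree contribute nothing to the component of degree `deg v`, so they are
    -- dropped. Adding the two indicators also covers `x = y`.
    refine ⟨.sum fun w => if K.deg w = K.deg v then
      (if w = x then a else 0) + (if w = y then b else 0) else 0, ?_, ?_⟩
    · have h1 := congrArg (homogeneousComponent (K.deg v)) hv
      rw [map_add, homogeneousComponent_C_mul, homogeneousComponent_C_mul,
        homogeneousComponent_of_isHomogeneous (hK.deg v),
        homogeneousComponent_of_isHomogeneous (hK.deg x),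
        homogeneousComponent_of_isHomogeneous (hK.deg y), if_pos rfl] at h1
      rw [h1]
      exact (sum_C_ite_mul (fun w => K.deg w = K.deg v) a b x y K.eval).symm
    · intro w hw
      have hd : K.deg w = K.deg v := by
        by_contra h
        simp [h] at hw
      refine ⟨hlt w ?_, hd⟩
      by_contra h
      simp only [Gate.children, List.mem_cons, List.not_mem_nil, or_false, not_or] at h
      simp [h.1, h.2] at hw
  | mul a b c x y z =>
    intro hv hlt
    simp only [Gate.value] at hv
    have hv' : K.eval v = C (a * b * c) * (K.eval x * K.eval y * K.eval z) := by
      rw [hv, C_mul, C_mul]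
      ring
    refine Rule.exists_holds_prod (a * b * c) x y z hv' ?_
      (hlt x (by simp [Gate.children])) (hlt y (by simp [Gate.children]))
      (hlt z (by simp [Gate.children]))
    refine deg_eq ?_ h0
    rw [hv', ← zero_add (K.deg x + _ + _)]
    exact (isHomogeneous_C _ _).mul (((hK.deg x).mul (hK.deg y)).mul (hK.deg z))

/-- The graded system of a homogeneous circuit. -/
noncomputable def IsHomogeneous.system [Fintype K.V] (hK : K.IsHomogeneous) :
    GradedSystem K.V where
  p := K.eval
  deg := K.deg
  rank := K.height
  rule v := (hK.exists_rule v).choose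
  hom := hK.deg
  deg_pos v := by
    unfold IHLCircuit.deg
    split_ifs with h
    · exact one_pos
    · obtain ⟨n, hn⟩ := hK v
      rw [hn.totalDegree h]
      exact K.pos_of_isHomogeneous_eval hn h
  spec v := (hK.exists_rule v).choose_spec

end IHLCircuit

/-! ### Homogenization of an arbitrary circuit. -/

theorem homogeneousComponent_monomial (n : ℕ) (m : ℕ →₀ ℕ) (c : ℂ) :
    homogeneousComponent n (monomial m c) = if m.degree = n then monomial m c else 0 :=
  homogeneousComponent_of_isHomogeneous (isHomogeneous_monomial c rfl) n

/-- Both sides are trilinear, so monomials suffice; there at most the term indexed by the three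
degrees survives. -/
theorem homogeneousComponent_mul_mul (p q r : Poly) {d j : ℕ} (hj : j ≤ d) :
    homogeneousComponent j (p * q * r) =
      ∑ a ∈ Finset.range (d + 1), ∑ b ∈ Finset.range (d + 1), ∑ e ∈ Finset.range (d + 1),
        if a + b + e = j then
          homogeneousComponent a p * homogeneousComponent b q * homogeneousComponent e r
        else 0 := by
  have ite_add' : ∀ (P : Prop) [Decidable P] (x y : Poly),
      (if P then x + y else 0) = (if P then x else 0) + if P then y else 0 := by
    intro P _ x y
    split_ifs <;> simp
  induction p using MvPolynomial.induction_on' with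
  | add p p' hp hp' =>
    simp only [add_mul, map_add, ite_add', Finset.sum_add_distrib, hp, hp']
  | monomial m c =>
    induction q using MvPolynomial.induction_on' with
    | add q q' hq hq' =>
      simp only [mul_add, add_mul, map_add, ite_add', Finset.sum_add_distrib, hq, hq']
    | monomial m' c' =>
      induction r using MvPolynomial.induction_on' with
      | add r r' hr hr' =>
        simp only [mul_add, map_add, ite_add', Finset.sum_add_distrib, hr, hr']
      | monomial m'' c'' =>
        have key : ∀ a b e : ℕ, (if a + b + e = j then
            homogeneousComponent a (monomial m c) * homogeneousComponent b (monomial m' c') *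
              homogeneousComponent e (monomial m'' c'') else 0) =
            if e = m''.degree then (if b = m'.degree then (if a = m.degree then
              (if m.degree + m'.degree + m''.degree = j then
                monomial (m + m' + m'') (c * c' * c'') else 0) else 0) else 0) else 0 := by
          intro a b e
          simp only [homogeneousComponent_monomial, eq_comm (b := Finsupp.degree _)]
          by_cases h1 : m''.degree = e
          · by_cases h2 : m'.degree = b
            · by_cases h3 : m.degree = a
              · subst h1 h2 h3
                simp [monomial_mul]
              · simp [h3]
            · simp [h2]
          · simp [h1]
        simp only [key]
        rw [monomial_mul, monomial_mul, homogeneousComponent_monomial]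
        simp only [Finset.sum_ite_eq', Finset.mem_range, map_add]
        by_cases h : m.degree + m'.degree + m''.degree = j
        · simp only [if_pos h, if_pos (by omega : m''.degree < d + 1), Finset.sum_ite_eq',
            Finset.mem_range, if_pos (by omega : m'.degree < d + 1),
            if_pos (by omega : m.degree < d + 1)]
        · simp [h]

namespace IHLCircuit

variable (K : IHLCircuit) (d : ℕ)

/-- The vertices of the homogenization up to degree `d`: one for every homogeneous component of
a gate, and one for every product of components of the factors of a gate. -/
abbrev HomVertex : Type :=
  K.V × Fin (d + 1) ⊕ K.V × Fin (d + 1) × Fin (d + 1) × Fin (d + 1)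

/-- The polynomials of the homogenization. -/
noncomputable def homPoly : K.HomVertex d → Poly
  | .inl (v, j) => homogeneousComponent j (K.eval v)
  | .inr (v, i, j, k) =>
    match K.gate v with
    | .mul a b c x y z => C (a * b * c) * (homogeneousComponent i (K.eval x) *
        homogeneousComponent j (K.eval y) * homogeneousComponent k (K.eval z))
    | _ => 0

/-- The degrees in the homogenization; components of degree `0` vanish and get degree `1`. -/
def homDeg : K.HomVertex d → ℕ
  | .inl (_, j) => max 1 (j : ℕ)
  | .inr (v, i, j, k) =>
    match K.gate v with
    | .mul _ _ _ _ _ _ => max 1 (i : ℕ) + max 1 (j : ℕ) + max 1 (k : ℕ)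
    | _ => 1

/-- An order of evaluation for the homogenization. -/
noncomputable def homRank : K.HomVertex d → ℕ
  | .inl (v, _) => 2 * K.height v + 1
  | .inr (v, _) => 2 * K.height v

theorem homogeneousComponent_zero_eval (v : K.V) : homogeneousComponent 0 (K.eval v) = 0 := by
  rw [homogeneousComponent_zero, ← constantCoeff_eq, K.constantCoeff_eval, map_zero]

theorem homogeneousComponent_eval_isHomogeneous (v : K.V) (j : ℕ) :
    (homogeneousComponent j (K.eval v)).IsHomogeneous (max 1 j) := by
  rcases Nat.eq_zero_or_pos j with rfl | hj
  · rw [K.homogeneousComponent_zero_eval]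
    exact isHomogeneous_zero _ _ _
  · rw [max_eq_right hj]
    exact homogeneousComponent_isHomogeneous j _

theorem homPoly_isHomogeneous (v : K.HomVertex d) :
    (K.homPoly d v).IsHomogeneous (K.homDeg d v) := by
  rcases v with ⟨v, j⟩ | ⟨v, i, j, k⟩
  · exact K.homogeneousComponent_eval_isHomogeneous v j
  · simp only [homPoly, homDeg]
    cases K.gate v with
    | leaf l hl => exact isHomogeneous_zero _ _ _
    | add a b x y => exact isHomogeneous_zero _ _ _
    | mul a b c x y z =>
      simp only
      rw [← zero_add (max 1 (i : ℕ) + _ + _)]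
      exact (isHomogeneous_C _ _).mul (((K.homogeneousComponent_eval_isHomogeneous x i).mul
        (K.homogeneousComponent_eval_isHomogeneous y j)).mul
        (K.homogeneousComponent_eval_isHomogeneous z k))

theorem homDeg_pos (v : K.HomVertex d) : 0 < K.homDeg d v := by
  rcases v with ⟨v, j⟩ | ⟨v, i, j, k⟩
  · simp [homDeg]
  · simp only [homDeg]
    cases K.gate v <;> simp

/-- A component of a product gate is the sum of the products of components of its factors. The
doubled heights in `homRank` place these products strictly between the components of the factors and
those of the gate. -/
theorem exists_homRule [Fintype K.V] (v : K.HomVertex d) :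
    ∃ r : Rule (K.HomVertex d), r.Holds (K.homPoly d) (K.homDeg d) (K.homRank d) v := by
  classical
  rcases v with ⟨v, j⟩ | ⟨v, i, j, k⟩
  · have hlt := fun u => K.height_lt_of_mem_children (u := u) (v := v)
    have hv := K.eval_eq v
    by_cases hj : (j : ℕ) ≤ 1
    · exact ⟨.lin, by simp only [Rule.Holds, homDeg]; omega⟩
    cases hg : K.gate v with
    | leaf l hl =>
      refine ⟨.sum 0, ?_, by simp⟩
      rw [hg] at hv
      simp only [homPoly, hv, Gate.value, Pi.zero_apply, map_zero, zero_mul,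
        Finset.sum_const_zero]
      rw [homogeneousComponent_of_isHomogeneous hl, if_neg (by omega)]
    | add a b x y =>
      rw [hg] at hv hlt
      refine ⟨.sum fun w => if True then (if w = .inl (x, j) then a else 0) +
        (if w = .inl (y, j) then b else 0) else 0, ?_, ?_⟩
      · rw [sum_C_ite_mul (fun _ => True)]
        simp only [homPoly, hv, Gate.value, map_add, homogeneousComponent_C_mul, if_true]
      · intro w hw
        have h : w = .inl (x, j) ∨ w = .inl (y, j) := by
          by_contra h
          rw [not_or] at h
          simp [h.1, h.2] at hw
        rcases h with rfl | rfl
        · have := hlt x (by simp [Gate.children])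
          exact ⟨by simp only [homRank]; omega, rfl⟩
        · have := hlt y (by simp [Gate.children])
          exact ⟨by simp only [homRank]; omega, rfl⟩
    | mul a b c x y z =>
      rw [hg] at hv
      -- Only positive indices are kept: the other products vanish, and their `homDeg` would exceed
      -- `j` because of the convention `max 1`.
      refine ⟨.sum (Sum.elim 0 fun w => if w.1 = v ∧ (0 < (w.2.1 : ℕ) ∧ 0 < (w.2.2.1 : ℕ) ∧
        0 < (w.2.2.2 : ℕ)) ∧ (w.2.1 : ℕ) + w.2.2.1 + w.2.2.2 = j then 1 else 0), ?_, ?_⟩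
      · have h1 : K.eval v = C (a * b * c) * (K.eval x * K.eval y * K.eval z) := by
          rw [hv]
          simp only [Gate.value, C_mul]
          ring
        rw [Fintype.sum_sum_type]
        simp only [Sum.elim_inl, Pi.zero_apply, map_zero, zero_mul, Finset.sum_const_zero,
          zero_add, Sum.elim_inr]
        rw [Fintype.sum_prod_type, Finset.sum_eq_single_of_mem v (Finset.mem_univ v)]
        · simp only [Fintype.sum_prod_type, homPoly, hg, true_and]
          rw [h1, homogeneousComponent_C_mul, homogeneousComponent_mul_mul _ _ _
            (Nat.lt_succ_iff.mp j.2), Finset.sum_range, Finset.mul_sum]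
          refine Finset.sum_congr rfl fun e _ => ?_
          rw [Finset.sum_range, Finset.mul_sum]
          refine Finset.sum_congr rfl fun f _ => ?_
          rw [Finset.sum_range, Finset.mul_sum]
          refine Finset.sum_congr rfl fun g _ => ?_
          by_cases h2 : (e : ℕ) + f + g = j
          · by_cases h3 : 0 < (e : ℕ) ∧ 0 < (f : ℕ) ∧ 0 < (g : ℕ)
            · simp [h2, h3]
            · have h4 : (e : ℕ) = 0 ∨ (f : ℕ) = 0 ∨ (g : ℕ) = 0 := by omega
              rw [if_neg (c := _ ∧ _) (fun h => h3 h.1)]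
              rcases h4 with h4 | h4 | h4 <;>
                simp [h4, K.homogeneousComponent_zero_eval]
          · simp [h2]
        · intro w _ hw
          simp [hw]
      · rintro (w | ⟨w, e, f, g⟩) hw
        · simp at hw
        · simp only [Sum.elim_inr, ne_eq, ite_eq_right_iff, one_ne_zero, imp_false,
            not_not] at hw
          obtain ⟨rfl, h2, h3⟩ := hw
          simp only [homRank, homDeg, hg]
          omega
  · have hlt := fun u => K.height_lt_of_mem_children (u := u) (v := v)
    cases hg : K.gate v with
    | leaf l hl => exact ⟨.lin, by simp only [Rule.Holds, homDeg, hg]⟩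
    | add a b x y => exact ⟨.lin, by simp only [Rule.Holds, homDeg, hg]⟩
    | mul a b c x y z =>
      rw [hg] at hlt
      have hx := hlt x (by simp [Gate.children])
      have hy := hlt y (by simp [Gate.children])
      have hz := hlt z (by simp [Gate.children])
      exact Rule.exists_holds_prod (a * b * c) (.inl (x, i)) (.inl (y, j)) (.inl (z, k))
        (by simp only [homPoly, hg]) (by simp only [homDeg, hg])
        (by simp only [homRank]; omega) (by simp only [homRank]; omega)
        (by simp only [homRank]; omega)

/-- The homogenization of a circuit up to degree `d`. -/
noncomputable def homogenization [Fintype K.V] : GradedSystem (K.HomVertex d) where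
  p := K.homPoly d
  deg := K.homDeg d
  rank := K.homRank d
  rule v := (K.exists_homRule d v).choose
  hom := K.homPoly_isHomogeneous d
  deg_pos := K.homDeg_pos d
  spec v := (K.exists_homRule d v).choose_spec

end IHLCircuit
-- Rebuilding the outer sum.
namespace SumTree

variable {V W : Type}

theorem exists_balanced (p : W → Poly) (h : W → ℕ) (f : Poly) (H k : ℕ) :
    ∀ l : List (SumTree W), l ≠ [] → l.length ≤ 2 ^ k →
      (∀ T ∈ l, T.height h ≤ H ∧ T.IsGradedFor p f) →
      ∃ T : SumTree W, T.height h ≤ H + k ∧ T.IsGradedFor p f ∧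
        T.eval p = (l.map (eval p)).sum ∧ T.consts = l.flatMap consts ∧
        T.oddIndices = l.flatMap oddIndices ∧ T.evenIndices = l.flatMap evenIndices ∧
        T.size + 1 = (l.map size).sum + l.length := by
  induction k with
  | zero =>
    intro l hne hl hT
    obtain ⟨T, rfl⟩ : ∃ T, l = [T] := List.length_eq_one_iff.mp (by
      have := List.length_pos_iff.mpr hne
      simp at hl
      omega)
    exact ⟨T, (hT T (by simp)).1, (hT T (by simp)).2, by simp, by simp, by simp, by simp, by simp⟩
  | succ k ih =>
    intro l hne hl hT
    by_cases hd : l.drop (2 ^ k) = []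
    · obtain ⟨T, h1, h2⟩ := ih l hne (by simpa using hd) hT
      exact ⟨T, by omega, h2⟩
    · have hpos : 0 < 2 ^ k := by positivity
      obtain ⟨S, a1, a2, a3, a4, a5, a6, a7⟩ := ih (l.take (2 ^ k))
        (by intro h0; simp [List.take_eq_nil_iff] at h0; exact hne h0) (by simp)
        (fun T hTl => hT T (List.mem_of_mem_take hTl))
      obtain ⟨T, b1, b2, b3, b4, b5, b6, b7⟩ := ih (l.drop (2 ^ k)) hd (by simp; omega)
        (fun T hTl => hT T (List.mem_of_mem_drop hTl))
      have e := List.take_append_drop (2 ^ k) l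
      refine ⟨.add S T, ?_, ⟨a2, b2⟩, ?_, ?_, ?_, ?_, ?_⟩
      · simp only [height]
        omega
      · rw [eval, a3, b3, ← List.sum_append, ← List.map_append, e]
      · rw [consts, a4, b4, ← List.flatMap_append, e]
      · rw [oddIndices, a5, b5, ← List.flatMap_append, e]
      · rw [evenIndices, a6, b6, ← List.flatMap_append, e]
      · have h1 : ((l.take (2 ^ k)).map size).sum + ((l.drop (2 ^ k)).map size).sum =
            (l.map size).sum := by
          rw [← List.sum_append, ← List.map_append, e]
        have h2 : (l.take (2 ^ k)).length + (l.drop (2 ^ k)).length = l.length := by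
          rw [← List.length_append, e]
        simp only [size]
        omega

/-- The nonvanishing summands of a graded sum, computed at other vertices. -/
theorem exists_summands {p : V → Poly} {p' : W → Poly} {h : W → ℕ} {f : Poly} {H : ℕ}
    (hW : ∀ v j, p v ≠ 0 → j ≤ f.totalDegree → (p v).IsHomogeneous j →
      ∃ w, p' w = p v ∧ h w ≤ H) (S : SumTree V) (hS : S.IsGradedFor p f) :
    ∃ l : List (SumTree W), (∀ T ∈ l, T.height h ≤ H + 1 ∧ T.IsGradedFor p' f) ∧
      (l.map (eval p')).sum = S.eval p ∧ l.flatMap consts = S.consts ∧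
      (l.flatMap oddIndices).Sublist S.oddIndices ∧
      (l.flatMap evenIndices).Sublist S.evenIndices ∧
      (∀ d ∈ l.flatMap oddIndices, Odd d ∧ d ≤ f.totalDegree) ∧
      (∀ d ∈ l.flatMap evenIndices, 2 ≤ f.totalDegree) ∧
      l.length = (l.flatMap consts).length + (l.flatMap oddIndices).length +
        (l.flatMap evenIndices).length ∧
      l.length ≤ S.size + 1 ∧ (l.map size).sum ≤ S.size := by
  induction S with
  | const c =>
    refine ⟨[.const c], ?_, by simp [eval], by simp [consts], by simp [oddIndices],
      by simp [evenIndices], by simp [oddIndices], by simp [evenIndices],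
      by simp [consts, oddIndices, evenIndices], by simp [size], by simp [size]⟩
    intro T hT
    obtain rfl := List.mem_singleton.mp hT
    exact ⟨Nat.zero_le _, hS⟩
  | odd d v =>
    by_cases h0 : p v = 0
    · exact ⟨[], by simp, by simp [eval, h0], by simp [consts], by simp, by simp, by simp,
        by simp, by simp, by simp, by simp⟩
    · have hd : d ≤ f.totalDegree := by
        by_contra hlt
        exact h0 (by rw [hS.2, homogeneousComponent_eq_zero _ _ (by omega)])
      obtain ⟨w, hw, hh⟩ := hW v d h0 hd
        (by rw [hS.2]; exact homogeneousComponent_isHomogeneous d f)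
      refine ⟨[.odd d w], ?_, by simp [eval, hw], by simp [consts], by simp [oddIndices],
        by simp [evenIndices], by simpa [oddIndices] using ⟨hS.1, hd⟩, by simp [evenIndices],
        by simp [consts, oddIndices, evenIndices], by simp [size], by simp [size]⟩
      intro T hT
      obtain rfl := List.mem_singleton.mp hT
      exact ⟨by simp only [height]; omega, hS.1, hw.trans hS.2⟩
  | even d i v =>
    by_cases h0 : p v = 0
    · exact ⟨[], by simp, by simp [eval, h0], by simp [consts], by simp, by simp, by simp,
        by simp, by simp, by simp, by simp⟩
    · obtain ⟨h1, h2, h3⟩ := hS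
      have hd : d ≤ f.totalDegree := by
        by_contra hlt
        exact h0 (by rw [h3, homogeneousComponent_eq_zero _ _ (by omega), map_zero])
      obtain ⟨w, hw, hh⟩ := hW v (d - 1) h0 (by omega)
        (by rw [h3]; exact (homogeneousComponent_isHomogeneous d f).pderiv)
      refine ⟨[.even d i w], ?_, by simp [eval, hw], by simp [consts], by simp [oddIndices],
        by simp [evenIndices], by simp [oddIndices], by simp [evenIndices]; omega,
        by simp [consts, oddIndices, evenIndices], by simp [size], by simp [size]⟩
      intro T hT
      obtain rfl := List.mem_singleton.mp hT
      exact ⟨by simp only [height]; omega, h1, h2, hw.trans h3⟩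
  | add S T ihS ihT =>
    obtain ⟨l, a1, a2, a3, a4, a5, a6, a7, a8, a9, a10⟩ := ihS hS.1
    obtain ⟨m, b1, b2, b3, b4, b5, b6, b7, b8, b9, b10⟩ := ihT hS.2
    refine ⟨l ++ m, ?_, ?_, ?_, ?_, ?_, ?_, ?_, ?_, ?_, ?_⟩
    · intro U hU
      exact (List.mem_append.mp hU).elim (a1 U) (b1 U)
    · rw [List.map_append, List.sum_append, a2, b2, eval]
    · rw [List.flatMap_append, a3, b3, consts]
    · rw [List.flatMap_append]
      exact a4.append b4
    · rw [List.flatMap_append]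
      exact a5.append b5
    · intro d hd
      rw [List.flatMap_append] at hd
      exact (List.mem_append.mp hd).elim (a6 d) (b6 d)
    · intro d hd
      rw [List.flatMap_append] at hd
      exact (List.mem_append.mp hd).elim (a7 d) (b7 d)
    · simp only [List.flatMap_append, List.length_append]
      omega
    · simp only [List.length_append, size]
      omega
    · simp only [List.map_append, List.sum_append, size]
      omega

end SumTree

namespace GradedCircuit

/-- Rebuilding a graded circuit on top of a homogeneous circuit for its blocks. -/
theorem exists_of_realizable {f : Poly} {G : GradedCircuit} (hG : G.Computes f) {M H k : ℕ}
    (hM : Realizable M {x | ∃ v j, G.body.eval v ≠ 0 ∧ j ≤ f.totalDegree ∧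
      (G.body.eval v).IsHomogeneous j ∧ x = (G.body.eval v, H)})
    (hk : 1 ≤ k) (hk' : 2 ≤ f.totalDegree → G.top.size + 1 ≤ 2 ^ k) :
    ∃ G' : GradedCircuit, G'.Computes f ∧ G'.IsHomogeneous ∧
      G'.size ≤ M + 2 * G.top.size + 1 ∧ G'.depth ≤ H + 1 + k := by
  obtain ⟨K, hK, hs, hr⟩ := hM
  obtain ⟨g1, g2, g3, g4, g5⟩ := hG
  obtain ⟨l, a1, a2, a3, a4, a5, a6, a7, a8, a9, a10⟩ :=
    SumTree.exists_summands (p' := K.eval) (h := K.height) (H := H)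
      (fun v j h0 hj hh => hr _ ⟨v, j, h0, hj, hh, rfl⟩) G.top g1
  rw [g5] at a2
  by_cases hl : l = []
  · subst hl
    have hf : f = 0 := by simpa using a2.symm
    refine ⟨⟨K, .const 0⟩, ⟨by simp [SumTree.IsGradedFor, hf], by simp [SumTree.consts],
      by simp [SumTree.oddIndices], by simp [SumTree.evenIndices], by simp [SumTree.eval, hf]⟩,
      hK, ?_, ?_⟩
    · simp only [size, SumTree.size]
      omega
    · simp [depth, SumTree.height]
  -- In degree at most one only `f(0)` and `f_1` can remain, so `1 ≤ k` suffices however many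
  -- vanishing summands `G` had. The depth must then be bounded by a constant.
  · have hlen : l.length ≤ 2 ^ k := by
      by_cases hd : 2 ≤ f.totalDegree
      · exact a9.trans (hk' hd)
      · have h1 : (l.flatMap SumTree.evenIndices).length = 0 := by
          rw [List.length_eq_zero_iff, List.eq_nil_iff_forall_not_mem]
          exact fun d hdm => hd (a7 d hdm)
        have h2 : (l.flatMap SumTree.oddIndices).length ≤ 1 := by
          have h3 : l.flatMap SumTree.oddIndices ⊆ [1] := by
            intro d hdm
            obtain ⟨⟨m, hm⟩, h4⟩ := a6 d hdm
            rw [List.mem_singleton]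
            omega
          simpa using ((a4.nodup g3).subperm h3).length_le
        have h3 : 2 ^ 1 ≤ 2 ^ k := Nat.pow_le_pow_right (by norm_num) hk
        rw [a8, a3, h1]
        omega
    obtain ⟨T, b1, b2, b3, b4, b5, b6, b7⟩ :=
      SumTree.exists_balanced K.eval K.height f (H + 1) k l hl hlen a1
    refine ⟨⟨K, T⟩, ⟨b2, by rw [b4, a3]; exact g2, by rw [b5]; exact a4.nodup g3,
      by rw [b6]; exact a5.nodup g4, by rw [b3]; exact a2⟩, hK, ?_, b1⟩
    simp only [size]
    omega

/-- A circuit with at most one vertex computes a polynomial of degree at most one. -/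
theorem totalDegree_le_one {f : Poly} {G : GradedCircuit} (hG : G.Computes f)
    (hs : G.size ≤ 1) : f.totalDegree ≤ 1 := by
  rw [← hG.2.2.2.2]
  have hV : ∀ v, (G.body.eval v).totalDegree ≤ 1 := by
    intro v
    have hlt := fun u => G.body.height_lt_of_mem_children (u := u) (v := v)
    have hu : ∀ u : G.body.V, u = v := fun u =>
      @Fintype.card_le_one_iff _ G.body.fintypeV |>.mp ((Nat.le_add_right _ _).trans hs) u v
    rw [G.body.eval_eq v]
    revert hlt
    cases G.body.gate v with
    | leaf l hl =>
      intro _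
      exact hl.totalDegree_le
    | add a b u w =>
      intro hlt
      have := hlt u (by simp [Gate.children])
      rw [hu u] at this
      omega
    | mul a b c u w x =>
      intro hlt
      have := hlt u (by simp [Gate.children])
      rw [hu u] at this
      omega
  have hT : G.top.size ≤ 1 := (Nat.le_add_left _ _).trans hs
  revert hT
  induction G.top with
  | const c => simp [SumTree.eval]
  | odd d v => exact fun _ => hV v
  | even d i v => simp [SumTree.size]
  | add S T ihS ihT =>
    intro hT
    simp only [SumTree.size] at hT
    exact (totalDegree_add _ _).trans (max_le (ihS (by omega)) (ihT (by omega)))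

end GradedCircuit
-- Numerical bounds and conclusion.
-- Rounding up costs at most `log 2 ≤ log n`, and `2 / log 2 < 3`.
theorem clog_two_le {n : ℕ} (hn : 2 ≤ n) : (Nat.clog 2 n : ℝ) ≤ 3 * Real.log n := by
  have h2 : (0.6931471803 : ℝ) < Real.log 2 := Real.log_two_gt_d9
  have hpos : 0 < Nat.clog 2 n := Nat.clog_pos (by norm_num) hn
  have h1 : 2 ^ (Nat.clog 2 n - 1) < n := Nat.pow_pred_clog_lt_self (by norm_num) hn
  have h3 : ((Nat.clog 2 n - 1 : ℕ) : ℝ) * Real.log 2 ≤ Real.log n := by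
    rw [← Real.log_pow]
    exact Real.log_le_log (by positivity) (by exact_mod_cast h1.le)
  have h4 : Real.log 2 ≤ Real.log n := Real.log_le_log (by norm_num) (by exact_mod_cast hn)
  rw [Nat.cast_sub hpos, Nat.cast_one] at h3
  have h5 : (Nat.clog 2 n : ℝ) * Real.log 2 ≤ 2 * Real.log n := by linarith
  have h6 : (0 : ℝ) ≤ Nat.clog 2 n := Nat.cast_nonneg _
  nlinarith

/-- Four levels double the degree bound, since `(6 / 5) ^ 4 = 1296 / 625 > 2`. -/
theorem pow_five_mul_le (d : ℕ) : 5 ^ (4 * Nat.clog 2 d) * d ≤ 6 ^ (4 * Nat.clog 2 d) := by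
  have h1 : d ≤ 2 ^ Nat.clog 2 d := Nat.le_pow_clog (by norm_num) d
  calc 5 ^ (4 * Nat.clog 2 d) * d ≤ 5 ^ (4 * Nat.clog 2 d) * 2 ^ Nat.clog 2 d :=
        Nat.mul_le_mul_left _ h1
    _ = 1250 ^ Nat.clog 2 d := by rw [pow_mul, ← mul_pow]; norm_num
    _ ≤ 1296 ^ Nat.clog 2 d := Nat.pow_le_pow_left (by norm_num) _
    _ = 6 ^ (4 * Nat.clog 2 d) := by rw [pow_mul]; norm_num

theorem GradedCircuit.size_pos (G : GradedCircuit) : 0 < G.size := by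
  by_contra h
  have h1 : G.body.size = 0 ∧ G.top.size = 0 := by
    simp only [size] at h
    omega
  have hV : G.body.V → False := fun v =>
    ((@Fintype.card_eq_zero_iff _ G.body.fintypeV).mp h1.1).false v
  have h2 := h1.2
  revert h2
  cases G.top with
  | const c => simp [SumTree.size]
  | odd d v => exact (hV v).elim
  | even d i v => exact (hV v).elim
  | add S T => simp [SumTree.size]

/-- Depth reduction for a graded circuit whose blocks occur in a graded system of polynomial
size. -/
theorem GradedCircuit.depth_reduction {f : Poly} {G : GradedCircuit} (hG : G.Computes f) {e : ℕ}
    {V : Type} [Fintype V] (S : GradedSystem V) (hV : Fintype.card V ≤ 16 * G.size ^ e)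
    (hS : ∀ v j, G.body.eval v ≠ 0 → j ≤ f.totalDegree → (G.body.eval v).IsHomogeneous j →
      ∃ w, S.p w = G.body.eval v ∧ S.deg w = j) :
    ∃ G' : GradedCircuit, G'.Computes f ∧ G'.IsHomogeneous ∧
      G'.size ≤ 200000 * (e + 1) * G.size ^ (200000 * (e + 1)) ∧
      (G'.depth : ℝ) ≤ (200000 * (e + 1) : ℕ) *
        (1 + Real.log G.size * Real.log f.totalDegree) := by
  set s := G.size with hs
  set d := f.totalDegree with hd
  have hs0 : 0 < s := G.size_pos
  have hsσ : s ≤ 2 ^ Nat.clog 2 s := Nat.le_pow_clog (by norm_num) s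
  have hcard : Fintype.card V ≤ 2 ^ (4 + e * Nat.clog 2 s) := by
    calc Fintype.card V ≤ 16 * s ^ e := hV
      _ ≤ 16 * (2 ^ Nat.clog 2 s) ^ e := Nat.mul_le_mul_left _ (Nat.pow_le_pow_left hsσ e)
      _ = 2 ^ (4 + e * Nat.clog 2 s) := by rw [pow_add, ← pow_mul, mul_comm e]; norm_num
  have htop : G.top.size ≤ s := Nat.le_add_left _ _
  -- For `d ≥ 2` this keeps `log s` away from zero, so rounded logarithms are bounded by multiples
  -- of true ones.
  have hds : 2 ≤ d → 2 ≤ s := by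
    intro h
    by_contra hlt
    have := totalDegree_le_one hG (by omega)
    omega
  have hreal := S.realizable hcard (4 * Nat.clog 2 d)
  obtain ⟨G', c1, c2, c3, c4⟩ := exists_of_realizable hG
    (k := if d ≤ 1 then 1 else 2 * Nat.clog 2 s) (hreal.subset le_rfl (by
      rintro x ⟨v, j, h0, hj, hh, rfl⟩
      obtain ⟨w, hw, hw'⟩ := hS v j h0 hj hh
      exact ⟨w, (Nat.mul_le_mul_left _ (hw'.trans_le hj)).trans (pow_five_mul_le d),
        by rw [hw]⟩)) (by
      split_ifs with h
      · exact le_rfl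
      · have := Nat.clog_pos (b := 2) (by norm_num) (hds (by omega))
        omega) (by
      intro h
      have h2 := hds h
      rw [if_neg (by omega), mul_comm, pow_mul]
      nlinarith)
  refine ⟨G', c1, c2, ?_, ?_⟩
  · have h1 : s ≤ s ^ (4 * e + 1) := Nat.le_self_pow (by omega) s
    have h2 : Fintype.card V ^ 4 ≤ 65536 * s ^ (4 * e + 1) := by
      calc Fintype.card V ^ 4 ≤ (16 * s ^ e) ^ 4 := Nat.pow_le_pow_left hV 4
        _ = 65536 * s ^ (4 * e) := by rw [mul_pow, ← pow_mul, mul_comm e]; norm_num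
        _ ≤ 65536 * s ^ (4 * e + 1) :=
          Nat.mul_le_mul_left _ (Nat.pow_le_pow_right hs0 (by omega))
    -- The constant covers `3 * 65536` from the blocks and `3` from the top.
    calc G'.size ≤ 200000 * s ^ (4 * e + 1) := by omega
      _ ≤ 200000 * (e + 1) * s ^ (200000 * (e + 1)) :=
        Nat.mul_le_mul (by omega) (Nat.pow_le_pow_right hs0 (by omega))
  · by_cases h : d ≤ 1
    · have hd0 : Nat.clog 2 d = 0 := Nat.clog_of_right_le_one h 2
      rw [if_pos h, hd0] at c4
      have hlog : Real.log d = 0 := by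
        interval_cases d <;> simp
      rw [hlog, mul_zero, add_zero, mul_one]
      exact_mod_cast (by omega : G'.depth ≤ 200000 * (e + 1))
    · have hd2 : 2 ≤ d := by omega
      have hs2 := hds hd2
      rw [if_neg h] at c4
      have hσ := Nat.clog_pos (b := 2) (by norm_num) hs2
      have hδ := Nat.clog_pos (b := 2) (by norm_num) hd2
      -- With `σ`, `δ` the rounded logarithms of `s`, `d`, the depth is at most `4δ · 2(5 + eσ) + 1
      -- + 2σ`, and `σ, δ ≥ 1`.
      have h1 : G'.depth ≤ (43 + 8 * e) * (Nat.clog 2 s * Nat.clog 2 d) := by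
        refine c4.trans ?_
        have e1 : Nat.clog 2 d ≤ Nat.clog 2 s * Nat.clog 2 d := Nat.le_mul_of_pos_left _ hσ
        have e2 : Nat.clog 2 s ≤ Nat.clog 2 s * Nat.clog 2 d := Nat.le_mul_of_pos_right _ hδ
        have e3 : 1 ≤ Nat.clog 2 s * Nat.clog 2 d := Nat.mul_pos hσ hδ
        nlinarith
      have h2 : ((Nat.clog 2 s : ℝ) * Nat.clog 2 d) ≤ (3 * Real.log s) * (3 * Real.log d) :=
        mul_le_mul (clog_two_le hs2) (clog_two_le hd2) (Nat.cast_nonneg _)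
          (mul_nonneg (by norm_num) (Real.log_natCast_nonneg s))
      have h3 : 0 ≤ Real.log s * Real.log d :=
        mul_nonneg (Real.log_natCast_nonneg s) (Real.log_natCast_nonneg d)
      have h4 : (G'.depth : ℝ) ≤ (43 + 8 * e) * ((Nat.clog 2 s : ℝ) * Nat.clog 2 d) := by
        exact_mod_cast h1
      have he : (0 : ℝ) ≤ e := Nat.cast_nonneg e
      calc (G'.depth : ℝ) ≤ (43 + 8 * e) * ((3 * Real.log s) * (3 * Real.log d)) :=
            h4.trans (mul_le_mul_of_nonneg_left h2 (by positivity))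
        _ = (387 + 72 * e) * (Real.log s * Real.log d) := by ring
        _ ≤ (200000 * (e + 1)) * (Real.log s * Real.log d) :=
            mul_le_mul_of_nonneg_right (by linarith) h3
        _ ≤ (200000 * (e + 1)) * (1 + Real.log s * Real.log d) :=
            mul_le_mul_of_nonneg_left (by linarith) (by positivity)
        _ = _ := by push_cast; ring

end ArityThree

theorem mainTheorem6 :
    (∃ c : ℕ, ∀ (f : ArityThree.Poly) (G : ArityThree.GradedCircuit),
      G.Computes f → G.IsHomogeneous →
      ∃ G' : ArityThree.GradedCircuit, G'.Computes f ∧ G'.IsHomogeneous ∧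
        G'.size ≤ c * G.size ^ c ∧
        (G'.depth : ℝ) ≤ c * (1 + Real.log G.size * Real.log f.totalDegree)) ∧
    (∀ k : ℕ, ∃ c : ℕ, ∀ (f : ArityThree.Poly) (G : ArityThree.GradedCircuit),
      G.Computes f → f.totalDegree ≤ G.size ^ k →
      ∃ G' : ArityThree.GradedCircuit, G'.Computes f ∧ G'.IsHomogeneous ∧
        G'.size ≤ c * G.size ^ c ∧
        (G'.depth : ℝ) ≤ c * (1 + Real.log G.size * Real.log f.totalDegree)) := by
  constructor
  · refine ⟨200000 * (1 + 1), fun f G hG hH => ?_⟩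
    let _ := G.body.fintypeV
    refine ArityThree.GradedCircuit.depth_reduction hG (e := 1)
      (ArityThree.IHLCircuit.IsHomogeneous.system hH) ?_ ?_
    · have h1 : Fintype.card G.body.V ≤ G.size := Nat.le_add_right G.body.size _
      rw [pow_one]
      omega
    · intro v j h0 _ hh
      exact ⟨v, rfl, ArityThree.IHLCircuit.deg_eq hh h0⟩
  · intro k
    -- The exponent `3 * k + 1` comes from the homogenization: at most `s` gates times `D + D ^ 3`
    -- indices, where `D = d + 1 ≤ 2 s ^ k`.
    refine ⟨200000 * (3 * k + 1 + 1), fun f G hG hk => ?_⟩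
    let _ := G.body.fintypeV
    refine ArityThree.GradedCircuit.depth_reduction hG (e := 3 * k + 1)
      (G.body.homogenization f.totalDegree) ?_ ?_
    · have h1 : Fintype.card G.body.V ≤ G.size := Nat.le_add_right G.body.size _
      have h2 : 0 < G.size ^ k := Nat.pow_pos G.size_pos
      have h3 : f.totalDegree + 1 ≤ 2 * G.size ^ k := by omega
      simp only [Fintype.card_sum, Fintype.card_prod, Fintype.card_fin]
      set D := f.totalDegree + 1 with hD
      have h4 : 1 ≤ D := by omega
      have h5 : D ≤ D * (D * D) := Nat.le_mul_of_pos_right _ (Nat.mul_pos h4 h4)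
      calc Fintype.card G.body.V * D + Fintype.card G.body.V * (D * (D * D))
          ≤ G.size * (2 * D ^ 3) := by
            rw [← mul_add]
            refine Nat.mul_le_mul h1 ?_
            calc D + D * (D * D) ≤ D * (D * D) + D * (D * D) := Nat.add_le_add_right h5 _
              _ = 2 * D ^ 3 := by ring
        _ ≤ G.size * (2 * (2 * G.size ^ k) ^ 3) :=
            Nat.mul_le_mul_left _ (Nat.mul_le_mul_left _ (Nat.pow_le_pow_left h3 3))
        _ = 16 * G.size ^ (3 * k + 1) := by
            rw [pow_add, pow_mul']
            ring
    · intro v j h0 hj hh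
      refine ⟨.inl (v, ⟨j, by omega⟩), ?_, ?_⟩
      · change MvPolynomial.homogeneousComponent j (G.body.eval v) = _
        rw [ArityThree.homogeneousComponent_of_isHomogeneous hh, if_pos rfl]
      · exact max_eq_right (G.body.pos_of_isHomogeneous_eval hh h0)
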